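/- Let $A\in\mathbb R^{m\times n}$ be such that $Ax=0$, $x\ge 0$ implies $x=0$ (for instance, all columns of $A$ are nonzero and nonnegative), and let $\gamma>0$, $\lambda>0$, $\rho>0$. Write $\langle\cdot,\cdot\rangle$ and $\|\cdot\|_F$ for the Frobenius inner product and norm, $\|\cdot\|_*$ for the nuclear norm, $\|\cdot\|_1$ for the entrywise $\ell^1$ norm, and for $L,S\in\mathbb R^{m\times n}$, $\mu\in\mathbb R^{n\times n}$ put $$M(L,S,\mu)=\begin{bmatrix} I & L+S-A\\ (L+S-A)^T & \gamma A^TA-\mu\end{bmatrix},\qquad \mathcal G(L,S,\mu)=\begin{bmatrix} 0 & L+S\\ (L+S)^T & -\mu\end{bmatrix}.$$ Consider the cone-preserving decomposition problem: minimize $f(L,S)=\|L\|_*+\lambda\|S\|_1$ over $(Z,L,S,\mu)$ subject to $Z=M(L,S,\mu)$, $Z\succeq 0$ and $\mu\ge 0$ entrywise. Its Lagrangian on $\{Z\succeq0,\ \mu\ge0\}$ is $\mathcal L(Z,L,S,\mu;Y)=f(L,S)+\langle Y,Z-M(L,S,\mu)\rangle$. The linearized ADMM with step size $\tau$ starts from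 $(Z^0,L^0,S^0,\mu^0,Y^0)$ and iterates, for $k\ge0$ (subscripts denote blocks): 1. $Z^{k+1}=Q\Lambda_+Q^T$, where $Q\Lambda Q^T$ is any eigenvalue decomposition of $M(L^k,S^k,\mu^k)-Y^k/\rho$ and $\Lambda_+$ replaces negative eigenvalues by $0$; 2. with $D^k=Z^{k+1}_{12}-L^k-S^k+A+Y^k_{12}/\rho$: $L^{k+1}=U\,\mathcal S_{\tau/\rho}(\Sigma)V^T$, where $U\Sigma V^T$ is any singular value decomposition of $L^k+2\tau D^k$; $S^{k+1}=\mathcal S_{\tau\lambda/\rho}(S^k+2\tau D^k)$ entrywise; and $\mu^{k+1}$ is the entrywise positive part of $\mu^k-\tau(Z^{k+1}_{22}-\gamma A^TA+\mu^k+Y^k_{22}/\rho)$. Here $\mathcal S_\theta(x)=\operatorname{sgn}(x)\max(|x|-\theta,0)$; 3. $Y^{k+1}=Y^k+\rho\,(Z^{k+1}-M(L^{k+1},S^{k+1},\mu^{k+1}))$. **Theorem.** If $m,n\ge1$, then $\mathcal G$ has operator norm $2$ with respect to the norms $(\|L\|_F^2+\|S\|_F^2+\|\mu\|_F^2)^{1/2}$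 and $\|\cdot\|_F$. Suppose $0<\tau<0.25$. Then the iteration can be carried out from every starting point with $\mu^0$ and $Y^0$ symmetric, and every sequence it produces, from any starting point, satisfies the following. (a) $(Z^k,L^k,S^k,\mu^k)$ converges to an optimal solution $(Z^\star,L^\star,S^\star,\mu^\star)$ of the problem. (b) The rate is $O(1/k)$ in the following (ergodic) sense. Let $\bar Z^k,\bar L^k,\bar S^k,\bar\mu^k$ be the averages of the iterates number $1,\dots,k$. There is a constant $C$ such that for all $k\ge1$ $$|f(\bar L^k,\bar S^k)-f(L^\star,S^\star)|\le \frac Ck,\qquad \|\bar Z^k-M(\bar L^k,\bar S^k,\bar\mu^k)\|_F\le\frac Ck .$$ Moreover, with $\hat Y^k=\frac1k\sum_{j=0}^{k-1}\bigl(Y^j+\rho(Z^{j+1}-M(L^j,S^j,\mu^j))\bigr)$, for all $k\ge 1$, all $Z\succeq0$, $L$, $S$, $\mu\ge0$ and $Y$, $$\mathcal L(\bar Z^k,\bar L^k,\bar S^k,\bar\mu^k;Y)-\mathcal L(Z,L,S,\mu;\hat Y^k)\le\frac1{2k}\Bigl(\frac\rho\tau\bigl(\|L-L^0\|_F^2+\|S-S^0\|_F^2+\|\mu-\mu^0\|_F^2\bigr)+\frac1\rho\|Y-Y^0\|_F^2\Bigr).$$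 -/

import Mathlib

open Filter Topology

namespace ConePreserving

noncomputable section

/-- The Frobenius inner product `⟨X, Y⟩ = ∑ᵢⱼ Xᵢⱼ Yᵢⱼ`. -/
def frobInner {p q : Type*} [Fintype p] [Fintype q] (X Y : Matrix p q ℝ) : ℝ :=
  ∑ i, ∑ j, X i j * Y i j

/-- The Frobenius norm. -/
def frobNorm {p q : Type*} [Fintype p] [Fintype q] (X : Matrix p q ℝ) : ℝ :=
  √(∑ i, ∑ j, X i j ^ 2)

/-- The nuclear norm: the sum of all singular values. (Singular values with index `≥ n` vanish.) -/
def nuclearNorm {m n : ℕ} (L : Matrix (Fin m) (Fin n) ℝ) : ℝ :=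
  ∑ i : Fin n, (Matrix.toEuclideanLin L).singularValues i

/-- The entrywise `ℓ¹` norm. -/
def l1Norm {m n : ℕ} (S : Matrix (Fin m) (Fin n) ℝ) : ℝ :=
  ∑ i, ∑ j, |S i j|

/-- The block matrix `[I, L + S - A; (L + S - A)ᵀ, γ AᵀA - μ]`. -/
def blockMat {m n : ℕ} (A : Matrix (Fin m) (Fin n) ℝ) (γ : ℝ)
    (L S : Matrix (Fin m) (Fin n) ℝ) (μ : Matrix (Fin n) (Fin n) ℝ) :
    Matrix (Fin m ⊕ Fin n) (Fin m ⊕ Fin n) ℝ :=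
  Matrix.fromBlocks 1 (L + S - A) (L + S - A).transpose (γ • (A.transpose * A) - μ)

/-- The linear part `𝒢(L, S, μ) = [0, L + S; (L + S)ᵀ, -μ]` of the constraint. -/
def opG {m n : ℕ} (L S : Matrix (Fin m) (Fin n) ℝ) (μ : Matrix (Fin n) (Fin n) ℝ) :
    Matrix (Fin m ⊕ Fin n) (Fin m ⊕ Fin n) ℝ :=
  Matrix.fromBlocks 0 (L + S) (L + S).transpose (-μ)

/-- The finite part `‖L‖_* + lam ‖S‖₁` of the objective. -/
def objective {m n : ℕ} (lam : ℝ) (L S : Matrix (Fin m) (Fin n) ℝ) : ℝ :=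
  nuclearNorm L + lam * l1Norm S

/-- `(Z, L, S, μ)` lies in the domain of the indicator terms and satisfies the linear constraint. -/
def IsFeasible {m n : ℕ} (A : Matrix (Fin m) (Fin n) ℝ) (γ : ℝ)
    (Z : Matrix (Fin m ⊕ Fin n) (Fin m ⊕ Fin n) ℝ)
    (L S : Matrix (Fin m) (Fin n) ℝ) (μ : Matrix (Fin n) (Fin n) ℝ) : Prop :=
  Z.PosSemidef ∧ (∀ i j, 0 ≤ μ i j) ∧ Z - blockMat A γ L S μ = 0

/-- `(Z, L, S, μ)` is an optimal solution of the cone-preserving decomposition problem. -/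
def IsOptimal {m n : ℕ} (A : Matrix (Fin m) (Fin n) ℝ) (γ lam : ℝ)
    (Z : Matrix (Fin m ⊕ Fin n) (Fin m ⊕ Fin n) ℝ)
    (L S : Matrix (Fin m) (Fin n) ℝ) (μ : Matrix (Fin n) (Fin n) ℝ) : Prop :=
  IsFeasible A γ Z L S μ ∧
    ∀ Z' L' S' μ', IsFeasible A γ Z' L' S' μ' → objective lam L S ≤ objective lam L' S'

/-- The (non-augmented) Lagrangian, on the domain `Z ⪰ 0`, `μ ≥ 0` of the indicator terms. -/
def lagrangian {m n : ℕ} (A : Matrix (Fin m) (Fin n) ℝ) (γ lam : ℝ)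
    (Z : Matrix (Fin m ⊕ Fin n) (Fin m ⊕ Fin n) ℝ)
    (L S : Matrix (Fin m) (Fin n) ℝ) (μ : Matrix (Fin n) (Fin n) ℝ)
    (Y : Matrix (Fin m ⊕ Fin n) (Fin m ⊕ Fin n) ℝ) : ℝ :=
  objective lam L S + frobInner Y (Z - blockMat A γ L S μ)

/-- The shrinkage operator `sgn(x) max(|x| - θ, 0)`. -/
def shrink (θ x : ℝ) : ℝ := Real.sign x * max (|x| - θ) 0

/-- `Z = Q Λ₊ Qᵀ` for some eigenvalue decomposition `W = Q Λ Qᵀ`. -/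
def IsPosPart {p : Type*} [Fintype p] [DecidableEq p] (W Z : Matrix p p ℝ) : Prop :=
  ∃ (Q : Matrix p p ℝ) (d : p → ℝ), Q.transpose * Q = 1 ∧
    W = Q * Matrix.diagonal d * Q.transpose ∧
    Z = Q * Matrix.diagonal (fun i => max (d i) 0) * Q.transpose

/-- `D = U 𝒮_θ(Σ) Vᵀ` for some (thin) singular value decomposition `X = U Σ Vᵀ`. -/
def IsSingularThreshold {m n : ℕ} (θ : ℝ) (X D : Matrix (Fin m) (Fin n) ℝ) : Prop :=
  ∃ (r : ℕ) (U : Matrix (Fin m) (Fin r) ℝ) (V : Matrix (Fin n) (Fin r) ℝ) (s : Fin r → ℝ),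
    U.transpose * U = 1 ∧ V.transpose * V = 1 ∧ (∀ i, 0 ≤ s i) ∧
    X = U * Matrix.diagonal s * V.transpose ∧
    D = U * Matrix.diagonal (fun i => shrink θ (s i)) * V.transpose

/-- The common increment `Z₁₂ - L - S + A + Y₁₂ / ρ` of the `L` and `S` updates. -/
def incr {m n : ℕ} (A : Matrix (Fin m) (Fin n) ℝ) (ρ : ℝ)
    (Z : Matrix (Fin m ⊕ Fin n) (Fin m ⊕ Fin n) ℝ) (L S : Matrix (Fin m) (Fin n) ℝ)
    (Y : Matrix (Fin m ⊕ Fin n) (Fin m ⊕ Fin n) ℝ) : Matrix (Fin m) (Fin n) ℝ :=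
  Z.toBlocks₁₂ - L - S + A + ρ⁻¹ • Y.toBlocks₁₂

/-- The sequences are produced by the linearized ADMM iteration with penalty `ρ` and
step size `τ` (the starting point is the value at `0`; any choice of the eigenvalue and
singular value decompositions is allowed in each step). -/
structure IsLADMM {m n : ℕ} (A : Matrix (Fin m) (Fin n) ℝ) (γ lam ρ τ : ℝ)
    (Z : ℕ → Matrix (Fin m ⊕ Fin n) (Fin m ⊕ Fin n) ℝ)
    (L S : ℕ → Matrix (Fin m) (Fin n) ℝ) (μ : ℕ → Matrix (Fin n) (Fin n) ℝ)
    (Y : ℕ → Matrix (Fin m ⊕ Fin n) (Fin m ⊕ Fin n) ℝ) : Prop where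
  stepZ : ∀ k, IsPosPart (blockMat A γ (L k) (S k) (μ k) - ρ⁻¹ • Y k) (Z (k + 1))
  stepL : ∀ k, IsSingularThreshold (τ / ρ)
    (L k + (2 * τ) • incr A ρ (Z (k + 1)) (L k) (S k) (Y k)) (L (k + 1))
  stepS : ∀ k, S (k + 1) =
    (S k + (2 * τ) • incr A ρ (Z (k + 1)) (L k) (S k) (Y k)).map (shrink (τ * lam / ρ))
  stepμ : ∀ k, μ (k + 1) =
    (μ k - τ • ((Z (k + 1)).toBlocks₂₂ - γ • (A.transpose * A) + μ k
      + ρ⁻¹ • (Y k).toBlocks₂₂)).map (fun x => max x 0)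
  stepY : ∀ k, Y (k + 1) =
    Y k + ρ • (Z (k + 1) - blockMat A γ (L (k + 1)) (S (k + 1)) (μ (k + 1)))

/-- The average `(X 1 + ⋯ + X k) / k`. -/
def avg {p q : Type*} (X : ℕ → Matrix p q ℝ) (k : ℕ) : Matrix p q ℝ :=
  (k : ℝ)⁻¹ • ∑ j ∈ Finset.range k, X (j + 1)

/-- The average over `j < k` of the predicted multipliers
`Yʲ + ρ (Zʲ⁺¹ - blockMat (Lʲ, Sʲ, μʲ))`. -/
def avgPredictedY {m n : ℕ} (A : Matrix (Fin m) (Fin n) ℝ) (γ ρ : ℝ)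
    (Z : ℕ → Matrix (Fin m ⊕ Fin n) (Fin m ⊕ Fin n) ℝ)
    (L S : ℕ → Matrix (Fin m) (Fin n) ℝ) (μ : ℕ → Matrix (Fin n) (Fin n) ℝ)
    (Y : ℕ → Matrix (Fin m ⊕ Fin n) (Fin m ⊕ Fin n) ℝ) (k : ℕ) :
    Matrix (Fin m ⊕ Fin n) (Fin m ⊕ Fin n) ℝ :=
  (k : ℝ)⁻¹ • ∑ j ∈ Finset.range k,
    (Y j + ρ • (Z (j + 1) - blockMat A γ (L j) (S j) (μ j)))

end

end ConePreserving

/-! After vectorization the problem reads: minimize φ(v) over v ∈ C subject to G v + c ∈ K. Step 1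
projects onto K. Step 2 is a proximal gradient step whose gradient is the adjoint of G applied to
the predicted multiplier Q = Yᵏ + ρ(Zᵏ⁺¹ - G yᵏ - c). Both steps enter only through their
variational inequalities. Their sum bounds the Lagrangian gap by a telescoping difference of a
weighted squared distance (`potential`), up to a cross term ⟨G a, p⟩ in the primal and dual
increments a, p. As ‖G‖ ≤ 2, this term is at most 2√τ times the potential of the increments, and τ <
1/4 makes 2√τ < 1 (`gap_add_potential_le`).

Measured from a saddle point the potential decreases and the increments tend to zero; cluster points
are saddle points, so the whole sequence converges (`exists_tendsto`). Summation and Jensen's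
inequality give the ergodic gap (`ergodic_gap_le`). The dual update telescopes, so the averaged
residual is (Yᵏ - Y⁰)/(ρk) with Yᵏ bounded; with the gap at multiplier 0 and the saddle inequality
this yields the rate (`ergodic_rate`).

The hypothesis on A serves to produce a saddle point (`exists_isSaddle`). A minimizer exists by
compactness, a multiplier by Hahn–Banach under Slater's condition. The Slater point comes from a
theorem of the alternative (`exists_nonneg_sub_mem_posQuad`): if γAᵀA - μ were never positive
definite for μ ≥ 0, separation would give a nonzero, entrywise nonnegative, semidefinite X with ⟨X,
AᵀA⟩ ≤ 0. Its rows would be nonnegative vectors in the kernel of A, hence zero.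

The nuclear norm is handled by duality: it is the maximum of ⟨K, ·⟩ over contractions K. This gives
convexity, continuity and the proximal inequality for singular value thresholding, whichever
decomposition is chosen. -/

namespace ConePreserving

noncomputable section

open scoped InnerProductSpace

/-! ### The weighted distance and its elementary bounds -/

section Potential

variable {E F : Type*} [NormedAddCommGroup E] [NormedAddCommGroup F] {ρ τ : ℝ}

/-- The weighted squared distance that decreases along the iteration. -/
def potential (ρ τ : ℝ) (u : F) (p : E) : ℝ :=
  ρ / (2 * τ) * ‖u‖ ^ 2 + 1 / (2 * ρ) * ‖p‖ ^ 2

lemma potential_nonneg (hρ : 0 < ρ) (hτ : 0 < τ) (u : F) (p : E) :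
    0 ≤ potential ρ τ u p := by
  unfold potential; positivity

/-- Arithmetic-geometric mean inequality with the weights of the potential; the factor √τ is the
origin of the step size threshold 1/4. -/
lemma two_mul_norm_mul_norm_le_potential (hρ : 0 < ρ) (hτ : 0 < τ) (u : F) (p : E) :
    2 * ‖u‖ * ‖p‖ ≤ 2 * √τ * potential ρ τ u p := by
  have hs : 0 < √τ := Real.sqrt_pos.2 hτ
  have h : 2 * √τ * potential ρ τ u p - 2 * ‖u‖ * ‖p‖
      = (ρ * ‖u‖ - √τ * ‖p‖) ^ 2 / (ρ * √τ) := by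
    unfold potential
    have h2 : τ = √τ ^ 2 := (Real.sq_sqrt hτ.le).symm
    generalize √τ = s at *
    subst h2
    field_simp
    ring
  have : 0 ≤ (ρ * ‖u‖ - √τ * ‖p‖) ^ 2 / (ρ * √τ) := by positivity
  linarith

lemma norm_le_of_potential_le (hρ : 0 < ρ) (hτ : 0 < τ) {u : F} {p : E} {B : ℝ}
    (hB : potential ρ τ u p ≤ B) : ‖u‖ ≤ √(2 * τ / ρ * B) ∧ ‖p‖ ≤ √(2 * ρ * B) := by
  unfold potential at hB
  have h1 : 0 ≤ ρ / (2 * τ) * ‖u‖ ^ 2 := by positivity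
  have h2 : 0 ≤ 1 / (2 * ρ) * ‖p‖ ^ 2 := by positivity
  constructor <;> apply Real.le_sqrt_of_sq_le
  · calc ‖u‖ ^ 2 = 2 * τ / ρ * (ρ / (2 * τ) * ‖u‖ ^ 2) := by field_simp
      _ ≤ _ := by gcongr; linarith
  · calc ‖p‖ ^ 2 = 2 * ρ * (1 / (2 * ρ) * ‖p‖ ^ 2) := by field_simp
      _ ≤ _ := by gcongr; linarith

lemma tendsto_zero_of_potential (hρ : 0 < ρ) (hτ : 0 < τ) {u : ℕ → F} {p : ℕ → E}
    (h : Tendsto (fun k => potential ρ τ (u k) (p k)) atTop (𝓝 0)) :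
    Tendsto u atTop (𝓝 0) ∧ Tendsto p atTop (𝓝 0) := by
  have aux : ∀ r : ℝ, Tendsto (fun k => √(r * potential ρ τ (u k) (p k))) atTop (𝓝 0) := by
    intro r
    simpa using (h.const_mul r).sqrt
  exact ⟨squeeze_zero_norm (fun k => (norm_le_of_potential_le hρ hτ le_rfl).1) (aux _),
    squeeze_zero_norm (fun k => (norm_le_of_potential_le hρ hτ le_rfl).2) (aux _)⟩

end Potential

/-! ### Abstract linearized ADMM and Lagrange multipliers in Hilbert spaces -/

section Abstract

variable {E F : Type*} [NormedAddCommGroup E] [InnerProductSpace ℝ E]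
  [NormedAddCommGroup F] [InnerProductSpace ℝ F]

/-- Sequences produced by the linearized ADMM for minimizing `φ v` over `v ∈ C` subject to
`G v + c ∈ K`. The two proximal steps are given by their variational inequalities. -/
structure IsLinearizedADMM (K : Set E) (C : Set F) (φ : F → ℝ) (G : F →L[ℝ] E) (c : E)
    (ρ τ : ℝ) (Z : ℕ → E) (y : ℕ → F) (Y : ℕ → E) : Prop where
  mem_K : ∀ k, Z (k + 1) ∈ K
  mem_C : ∀ k, y (k + 1) ∈ C
  proj : ∀ k, ∀ W ∈ K, 0 ≤ ⟪Y k + ρ • (Z (k + 1) - G (y k) - c), W - Z (k + 1)⟫_ℝ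
  prox : ∀ k, ∀ v ∈ C, φ (y (k + 1)) + ρ / τ * ⟪y k - y (k + 1), v - y (k + 1)⟫_ℝ
    + ⟪Y k + ρ • (Z (k + 1) - G (y k) - c), G (v - y (k + 1))⟫_ℝ ≤ φ v
  dual : ∀ k, Y (k + 1) = Y k + ρ • (Z (k + 1) - G (y (k + 1)) - c)

/-- `(G v + c, v)` and `Y` form a saddle point of the Lagrangian. -/
structure IsSaddle (K : Set E) (C : Set F) (φ : F → ℝ) (G : F →L[ℝ] E) (c : E)
    (v : F) (Y : E) : Prop where
  mem_C : v ∈ C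
  mem_K : G v + c ∈ K
  le : ∀ W ∈ K, ∀ u ∈ C, φ v ≤ φ u + ⟪Y, W - G u - c⟫_ℝ

namespace IsLinearizedADMM

variable {K : Set E} {C : Set F} {φ : F → ℝ} {G : F →L[ℝ] E} {c : E} {ρ τ : ℝ}
  {Z : ℕ → E} {y : ℕ → F} {Y : ℕ → E}

/-- Sum of the projection and proximal inequalities. It is kept in this raw form because its
right-hand side vanishes in the limit along a convergent subsequence. -/
lemma gap_le (h : IsLinearizedADMM K C φ G c ρ τ Z y Y) (k : ℕ) {W : E} (hW : W ∈ K)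
    {v : F} (hv : v ∈ C) (P : E) :
    φ (y (k + 1)) + ⟪P, Z (k + 1) - G (y (k + 1)) - c⟫_ℝ
      - (φ v + ⟪Y k + ρ • (Z (k + 1) - G (y k) - c), W - G v - c⟫_ℝ)
    ≤ - (ρ / τ * ⟪y k - y (k + 1), v - y (k + 1)⟫_ℝ)
      + ⟪P - (Y k + ρ • (Z (k + 1) - G (y k) - c)), Z (k + 1) - G (y (k + 1)) - c⟫_ℝ := by
  have h1 := h.proj k W hW
  have h2 := h.prox k v hv
  generalize Y k + ρ • (Z (k + 1) - G (y k) - c) = Q at *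
  simp only [map_sub, inner_sub_right, inner_sub_left] at *
  linarith

lemma gap_add_potential_le (h : IsLinearizedADMM K C φ G c ρ τ Z y Y) (hρ : 0 < ρ) (hτ : 0 < τ)
    (hG : ∀ u, ‖G u‖ ≤ 2 * ‖u‖) (k : ℕ) {W : E} (hW : W ∈ K) {v : F} (hv : v ∈ C) (P : E) :
    φ (y (k + 1)) + ⟪P, Z (k + 1) - G (y (k + 1)) - c⟫_ℝ
      - (φ v + ⟪Y k + ρ • (Z (k + 1) - G (y k) - c), W - G v - c⟫_ℝ)
      + potential ρ τ (v - y (k + 1)) (P - Y (k + 1))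
      + (1 - 2 * √τ) * potential ρ τ (y (k + 1) - y k) (Y (k + 1) - Y k)
    ≤ potential ρ τ (v - y k) (P - Y k) := by
  have h1 := h.gap_le k hW hv P
  have hR : Z (k + 1) - G (y (k + 1)) - c = ρ⁻¹ • (Y (k + 1) - Y k) := by
    rw [h.dual k, add_sub_cancel_left, smul_smul, inv_mul_cancel₀ hρ.ne', one_smul]
  -- The predicted multiplier uses the old `y k`; this discrepancy is the only source of the cross
  -- term `⟪G a, p⟫`.
  have hQ : Y k + ρ • (Z (k + 1) - G (y k) - c) = Y (k + 1) + ρ • G (y (k + 1) - y k) := by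
    rw [h.dual k, add_assoc, ← smul_add, map_sub]
    congr 2
    abel
  rw [hQ] at h1 ⊢
  rw [hR] at h1 ⊢
  set a := y (k + 1) - y k with ha
  set p := Y (k + 1) - Y k with hp
  have e1 : v - y k = (v - y (k + 1)) + a := by rw [ha]; abel
  have e2 : P - Y k = (P - Y (k + 1)) + p := by rw [hp]; abel
  have e3 : y k - y (k + 1) = -a := by rw [ha]; abel
  have e4 : P - (Y (k + 1) + ρ • G a) = (P - Y (k + 1)) - ρ • G a := by abel
  rw [e3, e4] at h1
  rw [e1, e2]
  generalize v - y (k + 1) = b at *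
  generalize P - Y (k + 1) = q at *
  have hc : -⟪G a, p⟫_ℝ ≤ 2 * ‖a‖ * ‖p‖ := by
    calc -⟪G a, p⟫_ℝ ≤ |⟪G a, p⟫_ℝ| := neg_le_abs _
      _ ≤ ‖G a‖ * ‖p‖ := abs_real_inner_le_norm _ _
      _ ≤ 2 * ‖a‖ * ‖p‖ := by gcongr; exact hG a
  have hs := two_mul_norm_mul_norm_le_potential hρ hτ a p
  have key : potential ρ τ (b + a) (q + p) = potential ρ τ b q + potential ρ τ a p
      + ρ / τ * ⟪a, b⟫_ℝ + ρ⁻¹ * ⟪q, p⟫_ℝ := by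
    unfold potential
    rw [norm_add_sq_real, norm_add_sq_real, real_inner_comm b a]
    field_simp
    ring
  rw [key]
  have h3 : - (ρ / τ * ⟪-a, b⟫_ℝ) + ⟪q - ρ • G a, ρ⁻¹ • p⟫_ℝ
      = ρ / τ * ⟪a, b⟫_ℝ + ρ⁻¹ * ⟪q, p⟫_ℝ - ⟪G a, p⟫_ℝ := by
    simp only [inner_neg_left, inner_sub_left, inner_smul_left, inner_smul_right]
    simp
    field_simp
    ring
  rw [h3] at h1
  linarith

lemma two_sqrt_lt_one (hτ' : τ < 1 / 4) : 2 * √τ < 1 := by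
  have : √τ < 1 / 2 := by
    rw [Real.sqrt_lt' (by norm_num)]
    linarith
  linarith

/-- At a saddle point the gap is nonnegative and can be dropped. -/
lemma saddle_potential_le (h : IsLinearizedADMM K C φ G c ρ τ Z y Y) (hρ : 0 < ρ) (hτ : 0 < τ)
    (hG : ∀ u, ‖G u‖ ≤ 2 * ‖u‖) (k : ℕ) {v : F} {P : E} (hs : IsSaddle K C φ G c v P) :
    potential ρ τ (v - y (k + 1)) (P - Y (k + 1))
      + (1 - 2 * √τ) * potential ρ τ (y (k + 1) - y k) (Y (k + 1) - Y k)
    ≤ potential ρ τ (v - y k) (P - Y k) := by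
  have h1 := h.gap_add_potential_le hρ hτ hG k hs.mem_K hs.mem_C P
  have h2 := hs.le _ (h.mem_K k) _ (h.mem_C k)
  have h3 : G v + c - G v - c = 0 := by abel
  rw [h3, inner_zero_right] at h1
  linarith

lemma saddle_antitone (h : IsLinearizedADMM K C φ G c ρ τ Z y Y) (hρ : 0 < ρ) (hτ : 0 < τ)
    (hτ' : τ < 1 / 4) (hG : ∀ u, ‖G u‖ ≤ 2 * ‖u‖) {v : F} {P : E}
    (hs : IsSaddle K C φ G c v P) : Antitone fun k => potential ρ τ (v - y k) (P - Y k) := by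
  refine antitone_nat_of_succ_le fun k => ?_
  have h1 := h.saddle_potential_le hρ hτ hG k hs
  have h2 := potential_nonneg hρ hτ (y (k + 1) - y k) (Y (k + 1) - Y k)
  have h3 := two_sqrt_lt_one hτ'
  nlinarith

/-- The potential is monotone and bounded below, so its successive differences, which dominate the
potential of the increments, tend to zero. -/
lemma tendsto_increments (h : IsLinearizedADMM K C φ G c ρ τ Z y Y) (hρ : 0 < ρ) (hτ : 0 < τ)
    (hτ' : τ < 1 / 4) (hG : ∀ u, ‖G u‖ ≤ 2 * ‖u‖) {v : F} {P : E}
    (hs : IsSaddle K C φ G c v P) :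
    Tendsto (fun k => y (k + 1) - y k) atTop (𝓝 0) ∧
      Tendsto (fun k => Y (k + 1) - Y k) atTop (𝓝 0) := by
  apply tendsto_zero_of_potential hρ hτ
  have hlim := tendsto_atTop_ciInf (h.saddle_antitone hρ hτ hτ' hG hs)
    ⟨0, by rintro _ ⟨k, rfl⟩; exact potential_nonneg hρ hτ _ _⟩
  have hdiff := (hlim.sub (hlim.comp (tendsto_add_atTop_nat 1))).const_mul (1 - 2 * √τ)⁻¹
  rw [sub_self, mul_zero] at hdiff
  refine squeeze_zero (fun k => potential_nonneg hρ hτ _ _) (fun k => ?_) hdiff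
  have h1 := h.saddle_potential_le hρ hτ hG k hs
  have h3 := two_sqrt_lt_one hτ'
  rw [inv_mul_eq_div, le_div_iff₀ (by linarith)]
  simp only [Function.comp_apply]
  linarith

lemma exists_bound (h : IsLinearizedADMM K C φ G c ρ τ Z y Y) (hρ : 0 < ρ) (hτ : 0 < τ)
    (hτ' : τ < 1 / 4) (hG : ∀ u, ‖G u‖ ≤ 2 * ‖u‖) {v : F} {P : E}
    (hs : IsSaddle K C φ G c v P) : ∃ B, ∀ k, ‖y k‖ ≤ B ∧ ‖Y k‖ ≤ B := by
  set B₀ := potential ρ τ (v - y 0) (P - Y 0)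
  refine ⟨max (‖v‖ + √(2 * τ / ρ * B₀)) (‖P‖ + √(2 * ρ * B₀)), fun k => ?_⟩
  obtain ⟨h1, h2⟩ := norm_le_of_potential_le hρ hτ
    (h.saddle_antitone hρ hτ hτ' hG hs (Nat.zero_le k))
  constructor
  · refine le_trans ?_ (le_max_left _ _)
    linarith [norm_sub_norm_le (y k) v, norm_sub_rev v (y k)]
  · refine le_trans ?_ (le_max_right _ _)
    linarith [norm_sub_norm_le (Y k) P, norm_sub_rev P (Y k)]

/-- The iterates converge to a saddle point as soon as one exists. -/
theorem exists_tendsto [FiniteDimensional ℝ E] [FiniteDimensional ℝ F]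
    (h : IsLinearizedADMM K C φ G c ρ τ Z y Y) (hρ : 0 < ρ) (hτ : 0 < τ)
    (hτ' : τ < 1 / 4) (hG : ∀ u, ‖G u‖ ≤ 2 * ‖u‖) (hK : IsClosed K) (hC : IsClosed C)
    (hφ : Continuous φ) (hsad : ∃ v P, IsSaddle K C φ G c v P) :
    ∃ v P, IsSaddle K C φ G c v P ∧ Tendsto y atTop (𝓝 v) ∧ Tendsto Y atTop (𝓝 P) ∧
      Tendsto Z atTop (𝓝 (G v + c)) := by
  have : ProperSpace E := FiniteDimensional.proper_real E
  have : ProperSpace F := FiniteDimensional.proper_real F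
  obtain ⟨v₀, P₀, hs₀⟩ := hsad
  obtain ⟨B, hB⟩ := h.exists_bound hρ hτ hτ' hG hs₀
  obtain ⟨hdy, hdY⟩ := h.tendsto_increments hρ hτ hτ' hG hs₀
  obtain ⟨⟨v, P⟩, -, θ, hθ, hlim⟩ := tendsto_subseq_of_bounded
    (Metric.isBounded_closedBall (x := (0 : F × E)) (r := B)) (x := fun k => (y k, Y k))
    (fun k => by simpa [Prod.norm_def] using hB k)
  have hy : Tendsto (fun k => y (θ k)) atTop (𝓝 v) := (continuous_fst.tendsto _).comp hlim
  have hY : Tendsto (fun k => Y (θ k)) atTop (𝓝 P) := (continuous_snd.tendsto _).comp hlim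
  have hy1 : Tendsto (fun k => y (θ k + 1)) atTop (𝓝 v) := by
    simpa using (hdy.comp hθ.tendsto_atTop).add hy
  have hres : ∀ k, Z (k + 1) - G (y (k + 1)) - c = ρ⁻¹ • (Y (k + 1) - Y k) := fun k => by
    rw [h.dual k, add_sub_cancel_left, smul_smul, inv_mul_cancel₀ hρ.ne', one_smul]
  have hR : Tendsto (fun k => Z (k + 1) - G (y (k + 1)) - c) atTop (𝓝 0) := by
    simp only [hres]
    simpa using hdY.const_smul ρ⁻¹
  have hRθ := hR.comp hθ.tendsto_atTop
  have hZ1 : Tendsto (fun k => Z (θ k + 1)) atTop (𝓝 (G v + c)) := by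
    have := (hRθ.add ((G.continuous.tendsto _).comp hy1)).add_const c
    simp only [Function.comp_def, zero_add] at this
    refine this.congr fun k => ?_
    abel
  have hs : IsSaddle K C φ G c v P := by
    have hvC : v ∈ C := hC.mem_of_tendsto hy1 (Eventually.of_forall fun k => h.mem_C _)
    have hvK : G v + c ∈ K := hK.mem_of_tendsto hZ1 (Eventually.of_forall fun k => h.mem_K _)
    refine ⟨hvC, hvK, fun W hW u hu => ?_⟩
    -- Vanishing increments and residuals make the predicted multipliers share the limit `P`, so
    -- `gap_le` passes to the limit as the saddle inequality.
    have hQ : Tendsto (fun k => Y (θ k) + ρ • (Z (θ k + 1) - G (y (θ k)) - c)) atTop (𝓝 P) := by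
      have h1 := hY.add (((hZ1.sub ((G.continuous.tendsto _).comp hy)).sub_const c).const_smul ρ)
      have h2 : P + ρ • (G v + c - G v - c) = P := by
        have : G v + c - G v - c = 0 := by abel
        rw [this, smul_zero, add_zero]
      rwa [h2] at h1
    have hl : Tendsto (fun k => φ (y (θ k + 1)) + ⟪P, Z (θ k + 1) - G (y (θ k + 1)) - c⟫_ℝ
        - (φ u + ⟪Y (θ k) + ρ • (Z (θ k + 1) - G (y (θ k)) - c), W - G u - c⟫_ℝ)) atTop
        (𝓝 (φ v + ⟪P, (0 : E)⟫_ℝ - (φ u + ⟪P, W - G u - c⟫_ℝ))) :=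
      (((hφ.tendsto _).comp hy1).add (tendsto_const_nhds.inner hRθ)).sub
        (tendsto_const_nhds.add (hQ.inner tendsto_const_nhds))
    have hr : Tendsto (fun k => - (ρ / τ * ⟪y (θ k) - y (θ k + 1), u - y (θ k + 1)⟫_ℝ)
        + ⟪P - (Y (θ k) + ρ • (Z (θ k + 1) - G (y (θ k)) - c)),
          Z (θ k + 1) - G (y (θ k + 1)) - c⟫_ℝ) atTop
        (𝓝 (- (ρ / τ * ⟪v - v, u - v⟫_ℝ) + ⟪P - P, (0 : E)⟫_ℝ)) :=
      ((((hy.sub hy1).inner (tendsto_const_nhds.sub hy1)).const_mul _).neg).add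
        ((tendsto_const_nhds.sub hQ).inner hRθ)
    have := le_of_tendsto_of_tendsto' hl hr fun k => h.gap_le (θ k) hW hu P
    simp only [sub_self, inner_zero_left, inner_zero_right] at this
    linarith
  -- The cluster point is itself a saddle point, so the potential relative to it is monotone; zero
  -- along a subsequence forces zero overall.
  have hpot : Tendsto (fun k => potential ρ τ (v - y k) (P - Y k)) atTop (𝓝 0) := by
    have hanti := h.saddle_antitone hρ hτ hτ' hG hs
    have hlim := tendsto_atTop_ciInf hanti
      ⟨0, by rintro _ ⟨k, rfl⟩; exact potential_nonneg hρ hτ _ _⟩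
    have h0 : Tendsto (fun k => potential ρ τ (v - y (θ k)) (P - Y (θ k))) atTop (𝓝 0) := by
      have h1 : Tendsto (fun k => v - y (θ k)) atTop (𝓝 0) := by
        simpa using hy.const_sub v
      have h2 : Tendsto (fun k => P - Y (θ k)) atTop (𝓝 0) := by
        simpa using hY.const_sub P
      have := ((h1.norm.pow 2).const_mul (ρ / (2 * τ))).add
        ((h2.norm.pow 2).const_mul (1 / (2 * ρ)))
      simpa [potential] using this
    rwa [tendsto_nhds_unique (hlim.comp hθ.tendsto_atTop) h0] at hlim
  obtain ⟨h1, h2⟩ := tendsto_zero_of_potential hρ hτ hpot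
  have hyv : Tendsto y atTop (𝓝 v) := by simpa using h1.const_sub v
  refine ⟨v, P, hs, hyv, by simpa using h2.const_sub P, ?_⟩
  -- `Z 0` is arbitrary and obeys no residual relation, hence the shift.
  rw [← tendsto_add_atTop_iff_nat 1]
  have := (hR.add ((G.continuous.tendsto _).comp ((tendsto_add_atTop_iff_nat 1).2 hyv))).add_const c
  simp only [Function.comp_def, zero_add] at this
  refine this.congr fun k => ?_
  abel

/-- The ergodic primal-dual gap estimate. -/
theorem ergodic_gap_le (h : IsLinearizedADMM K C φ G c ρ τ Z y Y) (hρ : 0 < ρ) (hτ : 0 < τ)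
    (hτ' : τ < 1 / 4) (hG : ∀ u, ‖G u‖ ≤ 2 * ‖u‖) (hφ : ConvexOn ℝ C φ) {k : ℕ} (hk : 1 ≤ k)
    {W : E} (hW : W ∈ K) {v : F} (hv : v ∈ C) (P : E) :
    φ ((k : ℝ)⁻¹ • ∑ j ∈ Finset.range k, y (j + 1))
      + ⟪P, (k : ℝ)⁻¹ • ∑ j ∈ Finset.range k, Z (j + 1)
          - G ((k : ℝ)⁻¹ • ∑ j ∈ Finset.range k, y (j + 1)) - c⟫_ℝ
      - (φ v + ⟪(k : ℝ)⁻¹ • ∑ j ∈ Finset.range k, (Y j + ρ • (Z (j + 1) - G (y j) - c)),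
          W - G v - c⟫_ℝ)
    ≤ (k : ℝ)⁻¹ * potential ρ τ (v - y 0) (P - Y 0) := by
  have hk0 : (0 : ℝ) < k := by exact_mod_cast hk
  have hsum : ∀ N : ℕ, ∑ j ∈ Finset.range N, (φ (y (j + 1))
      + ⟪P, Z (j + 1) - G (y (j + 1)) - c⟫_ℝ
      - (φ v + ⟪Y j + ρ • (Z (j + 1) - G (y j) - c), W - G v - c⟫_ℝ))
      + potential ρ τ (v - y N) (P - Y N) ≤ potential ρ τ (v - y 0) (P - Y 0) := by
    intro N
    induction N with
    | zero => simp
    | succ N ih =>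
      rw [Finset.sum_range_succ]
      have h1 := h.gap_add_potential_le hρ hτ hG N hW hv P
      have h2 : 0 ≤ (1 - 2 * √τ) * potential ρ τ (y (N + 1) - y N) (Y (N + 1) - Y N) :=
        mul_nonneg (by linarith [two_sqrt_lt_one hτ']) (potential_nonneg hρ hτ _ _)
      linarith
  have hjen : φ ((k : ℝ)⁻¹ • ∑ j ∈ Finset.range k, y (j + 1))
      ≤ (k : ℝ)⁻¹ * ∑ j ∈ Finset.range k, φ (y (j + 1)) := by
    have := hφ.map_sum_le (t := Finset.range k) (w := fun _ => (k : ℝ)⁻¹)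
      (p := fun j => y (j + 1)) (fun _ _ => by positivity) (by simp [hk0.ne'])
      (fun j _ => h.mem_C j)
    simpa [Finset.smul_sum, Finset.mul_sum] using this
  have hR : (k : ℝ)⁻¹ • ∑ j ∈ Finset.range k, Z (j + 1)
      - G ((k : ℝ)⁻¹ • ∑ j ∈ Finset.range k, y (j + 1)) - c
      = (k : ℝ)⁻¹ • ∑ j ∈ Finset.range k, (Z (j + 1) - G (y (j + 1)) - c) := by
    rw [map_smul, map_sum, Finset.sum_sub_distrib, Finset.sum_sub_distrib, Finset.sum_const,
      Finset.card_range, smul_sub, smul_sub, ← Nat.cast_smul_eq_nsmul ℝ k c, smul_smul,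
      inv_mul_cancel₀ hk0.ne', one_smul]
  have hv' : φ v = (k : ℝ)⁻¹ * ∑ j ∈ Finset.range k, φ v := by
    simp [hk0.ne']
  have h1 := hsum k
  have h2 := potential_nonneg hρ hτ (v - y k) (P - Y k)
  rw [hR, inner_smul_right, inner_smul_left, inner_sum, sum_inner, hv']
  rw [Finset.sum_sub_distrib, Finset.sum_add_distrib, Finset.sum_add_distrib] at h1
  have h3 := mul_le_mul_of_nonneg_left (a := (k : ℝ)⁻¹)
    (sub_nonneg.2 (h2.trans (le_sub_iff_add_le'.2 h1)) |>.trans_eq (sub_zero _)) (by positivity)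
  simp only [conj_trivial, mul_zero] at h3 ⊢
  nlinarith

/-- The averaged residual and objective converge at the rate `1 / k`. -/
theorem ergodic_rate [FiniteDimensional ℝ E] [FiniteDimensional ℝ F]
    (h : IsLinearizedADMM K C φ G c ρ τ Z y Y) (hρ : 0 < ρ) (hτ : 0 < τ)
    (hτ' : τ < 1 / 4) (hG : ∀ u, ‖G u‖ ≤ 2 * ‖u‖) (hφ : ConvexOn ℝ C φ) (hKc : Convex ℝ K)
    {v : F} {P : E} (hs : IsSaddle K C φ G c v P) :
    ∃ B : ℝ, ∀ k : ℕ, 1 ≤ k →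
      |φ ((k : ℝ)⁻¹ • ∑ j ∈ Finset.range k, y (j + 1)) - φ v| ≤ B / k ∧
      ‖(k : ℝ)⁻¹ • ∑ j ∈ Finset.range k, Z (j + 1)
          - G ((k : ℝ)⁻¹ • ∑ j ∈ Finset.range k, y (j + 1)) - c‖ ≤ B / k := by
  obtain ⟨B, hB⟩ := h.exists_bound hρ hτ hτ' hG hs
  set B₁ := ρ⁻¹ * (B + B)
  have hB0 : 0 ≤ B := (norm_nonneg _).trans (hB 0).1
  set B₂ := potential ρ τ (v - y 0) (0 - Y 0)
  refine ⟨max B₁ (max B₂ (‖P‖ * B₁)), fun k hk => ?_⟩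
  have hk0 : (0 : ℝ) < k := by exact_mod_cast hk
  -- The residuals are `ρ⁻¹` times the dual increments, so their sum telescopes.
  have hR : (k : ℝ)⁻¹ • ∑ j ∈ Finset.range k, Z (j + 1)
      - G ((k : ℝ)⁻¹ • ∑ j ∈ Finset.range k, y (j + 1)) - c
      = (k : ℝ)⁻¹ • ρ⁻¹ • (Y k - Y 0) := by
    have : ∀ j, Z (j + 1) - G (y (j + 1)) - c = ρ⁻¹ • (Y (j + 1) - Y j) := fun j => by
      rw [h.dual j, add_sub_cancel_left, smul_smul, inv_mul_cancel₀ hρ.ne', one_smul]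
    rw [← Finset.sum_range_sub, Finset.smul_sum (r := ρ⁻¹)]
    simp_rw [← this]
    rw [map_smul, map_sum, Finset.sum_sub_distrib, Finset.sum_sub_distrib, Finset.sum_const,
      Finset.card_range, smul_sub, smul_sub, ← Nat.cast_smul_eq_nsmul ℝ k c, smul_smul,
      inv_mul_cancel₀ hk0.ne', one_smul]
  have hRn : ‖(k : ℝ)⁻¹ • ∑ j ∈ Finset.range k, Z (j + 1)
      - G ((k : ℝ)⁻¹ • ∑ j ∈ Finset.range k, y (j + 1)) - c‖ ≤ B₁ / k := by
    rw [hR, norm_smul, norm_smul, Real.norm_of_nonneg (by positivity),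
      Real.norm_of_nonneg (by positivity), inv_mul_eq_div]
    have := (norm_sub_le _ _).trans (add_le_add (hB k).2 (hB 0).2)
    gcongr
    exact mul_le_mul_of_nonneg_left this (by positivity)
  have hw : ∑ j ∈ Finset.range k, (k : ℝ)⁻¹ = 1 := by simp [hk0.ne']
  have hyC : (k : ℝ)⁻¹ • ∑ j ∈ Finset.range k, y (j + 1) ∈ C := by
    rw [Finset.smul_sum]
    exact hφ.1.sum_mem (fun _ _ => by positivity) hw fun j _ => h.mem_C j
  have hZK : (k : ℝ)⁻¹ • ∑ j ∈ Finset.range k, Z (j + 1) ∈ K := by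
    rw [Finset.smul_sum]
    exact hKc.sum_mem (fun _ _ => by positivity) hw fun j _ => h.mem_K j
  have hlow := hs.le _ hZK _ hyC
  -- With test multiplier 0 and the saddle point as comparison, both inner products vanish and only
  -- the objective difference remains.
  have hup := h.ergodic_gap_le hρ hτ hτ' hG hφ hk hs.mem_K hs.mem_C 0
  have h3 : G v + c - G v - c = 0 := by abel
  rw [h3, inner_zero_right, inner_zero_left, add_zero, add_zero, inv_mul_eq_div] at hup
  have hcs := real_inner_le_norm P ((k : ℝ)⁻¹ • ∑ j ∈ Finset.range k, Z (j + 1)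
      - G ((k : ℝ)⁻¹ • ∑ j ∈ Finset.range k, y (j + 1)) - c)
  have hcs' := hcs.trans (mul_le_mul_of_nonneg_left hRn (norm_nonneg P))
  rw [← mul_div_assoc] at hcs'
  have m1 : B₁ / k ≤ max B₁ (max B₂ (‖P‖ * B₁)) / k := by gcongr; exact le_max_left _ _
  have m2 : B₂ / k ≤ max B₁ (max B₂ (‖P‖ * B₁)) / k := by
    gcongr; exact (le_max_left _ _).trans (le_max_right _ _)
  have m3 : ‖P‖ * B₁ / k ≤ max B₁ (max B₂ (‖P‖ * B₁)) / k := by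
    gcongr; exact (le_max_right _ _).trans (le_max_right _ _)
  exact ⟨abs_le.2 ⟨by linarith, by linarith⟩, hRn.trans m1⟩

end IsLinearizedADMM

/-- Existence of a Lagrange multiplier under Slater's condition. -/
theorem exists_multiplier [CompleteSpace E] {O : Set E} {C : Set F} {φ : F → ℝ} {G : F →L[ℝ] E}
    {c : E} (hO : IsOpen O) (hOc : Convex ℝ O) (hφ : ConvexOn ℝ C φ) {r : ℝ}
    (hr : ∀ v ∈ C, G v + c ∈ O → r ≤ φ v) {v₀ : F} (hv₀ : v₀ ∈ C) (hv₀' : G v₀ + c ∈ O) :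
    ∃ P : E, ∀ W ∈ O, ∀ v ∈ C, r ≤ φ v + ⟪P, W - G v - c⟫_ℝ := by
  -- Strict epigraph of the perturbed optimal value, shifted by `r`. It is open since `O` is, and it
  -- misses the origin because `r` is a lower bound.
  set T : Set (E × ℝ) := {x | ∃ v ∈ C, x.1 + G v + c ∈ O ∧ φ v - r < x.2}
  have hTo : IsOpen T := by
    have : T = ⋃ v ∈ C, {x : E × ℝ | x.1 + G v + c ∈ O ∧ φ v - r < x.2} := by
      ext x
      simp only [T, Set.mem_iUnion, Set.mem_ofPred_eq, exists_prop]
    rw [this]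
    refine isOpen_biUnion fun v _ => IsOpen.inter (hO.preimage (by fun_prop)) ?_
    exact isOpen_lt continuous_const continuous_snd
  have hTc : Convex ℝ T := by
    rintro ⟨p, s⟩ ⟨v, hv, hp, hs⟩ ⟨q, t⟩ ⟨w, hw, hq, ht⟩ a b ha hb hab
    refine ⟨a • v + b • w, hφ.1 hv hw ha hb hab, ?_, ?_⟩
    · have e : (a • (p, s) + b • (q, t)).1 + G (a • v + b • w) + c
          = a • (p + G v + c) + b • (q + G w + c) := by
        have : c = a • c + b • c := by rw [← add_smul, hab, one_smul]
        simp only [map_add, map_smul, Prod.fst_add, Prod.smul_fst, smul_add]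
        nth_rw 1 [this]
        abel
      rw [e]
      exact hOc hp hq ha hb hab
    · have h1 := hφ.2 hv hw ha hb hab
      simp only [smul_eq_mul, Prod.snd_add, Prod.smul_snd] at h1 hs ht ⊢
      have hr' : r = a * r + b * r := by rw [← add_mul, hab, one_mul]
      rcases ha.eq_or_lt with rfl | ha
      · have : b = 1 := by linarith
        subst this
        nlinarith
      · nlinarith
  have h0 : (0 : E × ℝ) ∉ T := by
    rintro ⟨v, hv, h1, h2⟩
    have := hr v hv (by simpa using h1)
    simp only [Prod.snd_zero] at h2
    linarith
  obtain ⟨f, hf⟩ := geometric_hahn_banach_point_open hTc hTo h0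
  rw [map_zero] at hf
  set s := f (0, 1) with hsdef
  have hsplit : ∀ p t, f (p, t) = f (p, 0) + t * s := fun p t => by
    rw [hsdef, ← smul_eq_mul t, ← map_smul, ← map_add]
    simp
  -- The Slater point puts some `(0, t)` with `t > 0` into `T`, so the separating hyperplane is not
  -- vertical.
  have hspos : 0 < s := by
    have h1 := hf (0, |φ v₀ - r| + 1) ⟨v₀, hv₀, by simpa using hv₀',
      by simpa using (le_abs_self _).trans_lt (lt_add_one _)⟩
    rw [hsplit] at h1
    have h2 : f ((0 : E), (0 : ℝ)) = 0 := map_zero f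
    rw [h2, zero_add] at h1
    exact pos_of_mul_pos_right h1 (by positivity)
  let g : StrongDual ℝ E := s⁻¹ • f.comp (ContinuousLinearMap.inl ℝ E ℝ)
  refine ⟨(InnerProductSpace.toDual ℝ E).symm g, fun W hW v hv => ?_⟩
  rw [InnerProductSpace.toDual_symm_apply]
  have hg : g (W - G v - c) = s⁻¹ * f (W - G v - c, 0) := by simp [g]
  rw [hg]
  refine le_of_forall_pos_lt_add fun ε hε => ?_
  have h1 := hf (W - G v - c, φ v - r + ε) ⟨v, hv,
    by simpa only [sub_add_cancel, sub_right_comm _ (G v) c] using hW, by simpa using hε⟩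
  rw [hsplit] at h1
  have h2 := mul_pos (inv_pos.2 hspos) h1
  rw [mul_add, mul_comm (φ v - r + ε), inv_mul_cancel_left₀ hspos.ne'] at h2
  linarith

end Abstract

/-! ### The Frobenius inner product and diagonal factorizations -/

section FrobeniusInner

variable {p q r : Type*} [Fintype p] [Fintype q] [Fintype r]

lemma frobInner_eq_trace (X Y : Matrix p q ℝ) : frobInner X Y = (Y.transpose * X).trace := by
  simp only [frobInner, Matrix.trace, Matrix.diag, Matrix.mul_apply, Matrix.transpose_apply]
  rw [Finset.sum_comm]
  simp only [mul_comm]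

lemma frobInner_add_left (X Y W : Matrix p q ℝ) :
    frobInner (X + Y) W = frobInner X W + frobInner Y W := by
  simp [frobInner, add_mul, Finset.sum_add_distrib]

lemma frobInner_comm (X Y : Matrix p q ℝ) : frobInner X Y = frobInner Y X := by
  simp only [frobInner, mul_comm]

lemma frobInner_add_right (X Y W : Matrix p q ℝ) :
    frobInner X (Y + W) = frobInner X Y + frobInner X W := by
  simp only [frobInner_comm X, frobInner_add_left]

lemma frobInner_smul_left (a : ℝ) (X Y : Matrix p q ℝ) :
    frobInner (a • X) Y = a * frobInner X Y := by
  simp [frobInner, Finset.mul_sum, mul_assoc]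

lemma frobInner_smul_right (a : ℝ) (X Y : Matrix p q ℝ) :
    frobInner X (a • Y) = a * frobInner X Y := by
  simp only [frobInner_comm X, frobInner_smul_left]

lemma frobInner_neg_right (X Y : Matrix p q ℝ) : frobInner X (-Y) = -frobInner X Y := by
  simp [frobInner]

lemma frobInner_sub_left (X Y W : Matrix p q ℝ) :
    frobInner (X - Y) W = frobInner X W - frobInner Y W := by
  simp [frobInner, sub_mul, Finset.sum_sub_distrib]

lemma frobInner_sub_right (X Y W : Matrix p q ℝ) :
    frobInner X (Y - W) = frobInner X Y - frobInner X W := by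
  simp only [frobInner_comm X, frobInner_sub_left]

lemma frobInner_transpose (X Y : Matrix p q ℝ) :
    frobInner X.transpose Y.transpose = frobInner X Y := by
  simp only [frobInner, Matrix.transpose_apply]
  exact Finset.sum_comm

variable [DecidableEq r]

/-- Cyclicity of the trace. It reduces pairings with spectral or singular value decompositions to
diagonal entries. -/
lemma frobInner_mul_diagonal_mul (K : Matrix p q ℝ) (U : Matrix p r ℝ) (V : Matrix q r ℝ)
    (s : r → ℝ) : frobInner K (U * Matrix.diagonal s * V.transpose)
      = ∑ i, s i * (U.transpose * K * V) i i := by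
  rw [frobInner_eq_trace, Matrix.transpose_mul, Matrix.transpose_mul, Matrix.transpose_transpose,
    Matrix.diagonal_transpose, Matrix.mul_assoc, Matrix.trace_mul_comm, Matrix.mul_assoc,
    Matrix.mul_assoc, ← Matrix.mul_assoc U.transpose]
  simp [Matrix.trace, Matrix.diagonal_mul]

lemma frobInner_diagonal_diagonal {U : Matrix p r ℝ} {V : Matrix q r ℝ}
    (hU : U.transpose * U = 1) (hV : V.transpose * V = 1) (s t : r → ℝ) :
    frobInner (U * Matrix.diagonal s * V.transpose) (U * Matrix.diagonal t * V.transpose)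
      = ∑ i, t i * s i := by
  rw [frobInner_mul_diagonal_mul]
  have : U.transpose * (U * Matrix.diagonal s * V.transpose) * V = Matrix.diagonal s := by
    rw [Matrix.mul_assoc, Matrix.mul_assoc _ V.transpose, hV, Matrix.mul_one,
      ← Matrix.mul_assoc, hU, Matrix.one_mul]
  simp [this]

end FrobeniusInner

/-! ### Matrices of spectral norm at most one -/

section Contraction

variable {p q r : Type*} [Fintype p] [Fintype q] [Fintype r]

/-- A matrix of spectral norm at most one. -/
def IsContraction (K : Matrix p q ℝ) : Prop :=
  ∀ (u : p → ℝ) (v : q → ℝ), 2 * (u ⬝ᵥ K.mulVec v) ≤ u ⬝ᵥ u + v ⬝ᵥ v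

lemma dotProduct_self_nonneg' (u : p → ℝ) : 0 ≤ u ⬝ᵥ u :=
  Finset.sum_nonneg fun i _ => mul_self_nonneg (u i)

/-- Bessel's inequality, from expanding the squared length of `u - U Uᵀ u`. -/
lemma bessel_dotProduct [DecidableEq r] {U : Matrix p r ℝ} (hU : U.transpose * U = 1)
    (u : p → ℝ) :
    U.transpose.mulVec u ⬝ᵥ U.transpose.mulVec u ≤ u ⬝ᵥ u := by
  have h := dotProduct_self_nonneg' (u - U.mulVec (U.transpose.mulVec u))
  set w := U.transpose.mulVec u with hw
  have h1 : U.mulVec w ⬝ᵥ u = w ⬝ᵥ w := by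
    rw [dotProduct_comm, Matrix.dotProduct_mulVec, ← Matrix.mulVec_transpose, ← hw]
  have h2 : U.mulVec w ⬝ᵥ U.mulVec w = w ⬝ᵥ w := by
    rw [Matrix.dotProduct_mulVec, ← Matrix.mulVec_transpose, Matrix.mulVec_mulVec, hU,
      Matrix.one_mulVec]
  rw [sub_dotProduct, dotProduct_sub, dotProduct_sub, h2, dotProduct_comm u (U.mulVec w), h1] at h
  linarith

lemma isContraction_mul_diagonal_mul [DecidableEq r] {U : Matrix p r ℝ} {V : Matrix q r ℝ}
    (hU : U.transpose * U = 1) (hV : V.transpose * V = 1) {w : r → ℝ}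
    (h0 : ∀ i, 0 ≤ w i) (h1 : ∀ i, w i ≤ 1) :
    IsContraction (U * Matrix.diagonal w * V.transpose) := by
  intro u v
  have e : u ⬝ᵥ (U * Matrix.diagonal w * V.transpose).mulVec v
      = ∑ i, U.transpose.mulVec u i * (w i * V.transpose.mulVec v i) := by
    rw [← Matrix.mulVec_mulVec, ← Matrix.mulVec_mulVec, Matrix.dotProduct_mulVec,
      ← Matrix.mulVec_transpose]
    simp [dotProduct, Matrix.mulVec_diagonal]
  rw [e]
  refine le_trans ?_ (add_le_add (bessel_dotProduct hU u) (bessel_dotProduct hV v))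
  rw [dotProduct, dotProduct, Finset.mul_sum, ← Finset.sum_add_distrib]
  refine Finset.sum_le_sum fun i _ => ?_
  generalize U.transpose.mulVec u i = a
  generalize V.transpose.mulVec v i = b
  nlinarith [mul_nonneg (h0 i) (sq_nonneg (a - b)), mul_nonneg (sub_nonneg.2 (h1 i)) (sq_nonneg a),
    mul_nonneg (sub_nonneg.2 (h1 i)) (sq_nonneg b)]

lemma IsContraction.conj_apply_le_one {r : Type*} [DecidableEq r] {K : Matrix p q ℝ} (hK : IsContraction K)
    {U : Matrix p r ℝ} {V : Matrix q r ℝ}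
    (hU : U.transpose * U = 1) (hV : V.transpose * V = 1) (i : r) :
    (U.transpose * K * V) i i ≤ 1 := by
  have h := hK (fun a => U a i) (fun b => V b i)
  have hu : (fun a => U a i) ⬝ᵥ (fun a => U a i) = 1 := by
    have := congrFun (congrFun hU i) i
    simpa [Matrix.mul_apply, dotProduct] using this
  have hv : (fun a => V a i) ⬝ᵥ (fun a => V a i) = 1 := by
    have := congrFun (congrFun hV i) i
    simpa [Matrix.mul_apply, dotProduct] using this
  have e : (U.transpose * K * V) i i = (fun a => U a i) ⬝ᵥ K.mulVec (fun b => V b i) := by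
    rw [Matrix.mul_assoc]
    rfl
  rw [e]
  linarith

lemma IsContraction.abs_apply_le_one [DecidableEq p] [DecidableEq q] {K : Matrix p q ℝ}
    (hK : IsContraction K) (i : p) (j : q) : |K i j| ≤ 1 := by
  have h1 := hK (Pi.single i 1) (Pi.single j 1)
  have h2 := hK (Pi.single i (-1)) (Pi.single j 1)
  simp [Matrix.mulVec_single] at h1 h2
  rw [abs_le]
  constructor <;> linarith

lemma isContraction_single [DecidableEq p] [DecidableEq q] (i : p) (j : q) {c : ℝ}
    (hc : |c| = 1) : IsContraction (Matrix.single i j c) := by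
  intro u v
  have e : u ⬝ᵥ (Matrix.single i j c).mulVec v = c * (u i * v j) := by
    simp [Matrix.single_mulVec, dotProduct, Function.update_apply]
    ring
  have hu : u i * u i ≤ u ⬝ᵥ u :=
    Finset.single_le_sum (f := fun i => u i * u i) (fun i _ => mul_self_nonneg _)
      (Finset.mem_univ i)
  have hv : v j * v j ≤ v ⬝ᵥ v :=
    Finset.single_le_sum (f := fun i => v i * v i) (fun i _ => mul_self_nonneg _)
      (Finset.mem_univ j)
  rw [e]
  have h1 : c * (u i * v j) ≤ |u i * v j| := by
    calc _ ≤ |c * (u i * v j)| := le_abs_self _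
      _ = _ := by rw [abs_mul, hc, one_mul]
  have h2 : 2 * |u i * v j| ≤ u i * u i + v j * v j := by
    rw [abs_mul]
    nlinarith [sq_nonneg (|u i| - |v j|), sq_abs (u i), sq_abs (v j)]
  linarith

end Contraction

/-! ### Singular value decomposition and duality for the nuclear norm -/

section NuclearNorm

variable {m n : ℕ}

/-- The columns of `E` are an orthonormal eigenbasis of `XᵀX`, so the columns of `X E` are
orthogonal with the singular values as lengths. -/
lemma exists_orthogonal_gram_diagonal (X : Matrix (Fin m) (Fin n) ℝ) :
    ∃ E : Matrix (Fin n) (Fin n) ℝ, E.transpose * E = 1 ∧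
      (X * E).transpose * (X * E)
        = Matrix.diagonal fun i : Fin n => (Matrix.toEuclideanLin X).singularValues i ^ 2 := by
  set T := Matrix.toEuclideanLin X with hT
  have hn : Module.finrank ℝ (EuclideanSpace ℝ (Fin n)) = n := by simp
  set e := T.isSymmetric_adjoint_comp_self.eigenvectorBasis hn with he
  have hTe : ∀ j, T (e j) = WithLp.toLp 2 (X.mulVec (e j)) := fun j => rfl
  refine ⟨Matrix.of fun b j => e j b, ?_, ?_⟩
  · ext i j
    have h := orthonormal_iff_ite.1 e.orthonormal i j
    rw [PiLp.inner_apply] at h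
    simp only [Matrix.mul_apply, Matrix.transpose_apply, Matrix.of_apply, Matrix.one_apply]
    rw [← h]
    exact Finset.sum_congr rfl fun a _ => mul_comm _ _
  · ext i j
    have h : inner ℝ (T (e i)) (T (e j)) = if i = j then T.singularValues i ^ 2 else 0 := by
      have h1 := T.isSymmetric_adjoint_comp_self.apply_eigenvectorBasis hn j
      rw [← LinearMap.adjoint_inner_right, ← LinearMap.comp_apply, h1, inner_smul_right,
        orthonormal_iff_ite.1 e.orthonormal i j, T.sq_singularValues_fin hn i]
      split_ifs with hij
      · simp [hij]
      · simp
    rw [PiLp.inner_apply] at h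
    rw [Matrix.diagonal_apply, ← h]
    rw [Matrix.mul_apply]
    exact Finset.sum_congr rfl fun a _ => mul_comm _ _

/-- A thin singular value decomposition, with the nuclear norm read off from it. -/
lemma exists_thin_svd (X : Matrix (Fin m) (Fin n) ℝ) :
    ∃ (r : ℕ) (U : Matrix (Fin m) (Fin r) ℝ) (V : Matrix (Fin n) (Fin r) ℝ) (s : Fin r → ℝ),
      U.transpose * U = 1 ∧ V.transpose * V = 1 ∧ (∀ i, 0 ≤ s i) ∧
      X = U * Matrix.diagonal s * V.transpose ∧ ∑ i, s i = nuclearNorm X := by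
  obtain ⟨E, hE, hXE⟩ := exists_orthogonal_gram_diagonal X
  set σ : Fin n → ℝ := fun i => (Matrix.toEuclideanLin X).singularValues i with hσ
  have hσ0 : ∀ i, 0 ≤ σ i := fun i => LinearMap.singularValues_nonneg _ _
  have hE' : E * E.transpose = 1 := mul_eq_one_comm.1 hE
  let eqv := (Fintype.equivFin {i // σ i ≠ 0}).symm
  let ι : Fin (Fintype.card {i // σ i ≠ 0}) → Fin n := fun a => (eqv a).1
  have hι : Function.Injective ι := Subtype.val_injective.comp eqv.injective
  have hne : ∀ a, σ (ι a) ≠ 0 := fun a => (eqv a).2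
  have hout : ∀ j ∉ Set.range ι, σ j = 0 := by
    intro j hj
    by_contra h
    exact hj ⟨eqv.symm ⟨j, h⟩, by simp [ι]⟩
  have hgram : ∀ i j, ∑ a, (X * E) a i * (X * E) a j = if i = j then σ i ^ 2 else 0 := by
    intro i j
    have := congrFun (congrFun hXE i) j
    rwa [Matrix.mul_apply, Matrix.diagonal_apply] at this
  have hzero : ∀ j, σ j = 0 → ∀ a, (X * E) a j = 0 := by
    intro j hj a
    have := hgram j j
    rw [if_pos rfl, hj, zero_pow two_ne_zero,
      Finset.sum_eq_zero_iff_of_nonneg fun _ _ => mul_self_nonneg _] at this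
    simpa using this a (Finset.mem_univ a)
  -- Only indices with nonzero singular value are kept, so the columns of `X E` can be normalized to
  -- give `U`.
  refine ⟨_, Matrix.of fun a i => (σ (ι i))⁻¹ * (X * E) a (ι i), E.submatrix id ι,
    fun i => σ (ι i), ?_, ?_, fun i => hσ0 _, ?_, ?_⟩
  · ext i j
    have h := hgram (ι i) (ι j)
    simp only [Matrix.mul_apply (M := Matrix.transpose _), Matrix.transpose_apply,
      Matrix.of_apply, Matrix.one_apply]
    have : ∀ a, (σ (ι i))⁻¹ * (X * E) a (ι i) * ((σ (ι j))⁻¹ * (X * E) a (ι j))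
        = (σ (ι i))⁻¹ * (σ (ι j))⁻¹ * ((X * E) a (ι i) * (X * E) a (ι j)) := fun a => by ring
    simp only [this]
    rw [← Finset.mul_sum, h]
    by_cases hij : i = j
    · subst hij
      have := hne i
      simp only [if_true]
      field_simp
    · rw [if_neg (fun h => hij (hι h)), if_neg hij, mul_zero]
  · ext i j
    have := congrFun (congrFun hE (ι i)) (ι j)
    rw [Matrix.one_apply, Matrix.mul_apply] at this
    simp only [Matrix.mul_apply, Matrix.transpose_apply, Matrix.submatrix_apply, id,
      Matrix.one_apply] at this ⊢
    rw [this]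
    simp [hι.eq_iff]
  · ext a b
    have h1 : X a b = ∑ j, (X * E) a j * E b j := by
      have : X = X * E * E.transpose := by rw [Matrix.mul_assoc, hE', Matrix.mul_one]
      conv_lhs => rw [this]
      rw [Matrix.mul_apply]
      rfl
    rw [h1, Matrix.mul_apply]
    symm
    apply Fintype.sum_of_injective ι hι
    · intro j hj
      rw [hzero j (hout j hj), zero_mul]
    · intro i
      rw [Matrix.mul_diagonal]
      simp only [Matrix.of_apply, Matrix.transpose_apply, Matrix.submatrix_apply, id]
      have := hne i
      field_simp
  · unfold nuclearNorm
    exact Fintype.sum_of_injective ι hι _ _ (fun j hj => hout j hj) fun _ => rfl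

lemma IsContraction.frobInner_le_sum {K : Matrix (Fin m) (Fin n) ℝ} (hK : IsContraction K) {r : ℕ}
    {U : Matrix (Fin m) (Fin r) ℝ} {V : Matrix (Fin n) (Fin r) ℝ} {s : Fin r → ℝ}
    (hU : U.transpose * U = 1) (hV : V.transpose * V = 1) (hs : ∀ i, 0 ≤ s i) :
    frobInner K (U * Matrix.diagonal s * V.transpose) ≤ ∑ i, s i := by
  rw [frobInner_mul_diagonal_mul]
  refine Finset.sum_le_sum fun i _ => ?_
  exact mul_le_of_le_one_right (hs i) (hK.conj_apply_le_one hU hV i)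

lemma IsContraction.frobInner_le_nuclearNorm {K : Matrix (Fin m) (Fin n) ℝ} (hK : IsContraction K)
    (X : Matrix (Fin m) (Fin n) ℝ) : frobInner K X ≤ nuclearNorm X := by
  obtain ⟨r, U, V, s, hU, hV, hs, hX, hsum⟩ := exists_thin_svd X
  rw [← hsum]
  conv_lhs => rw [hX]
  exact hK.frobInner_le_sum hU hV hs

/-- The maximum in the duality is attained at `K = U Vᵀ`. This replaces all direct work with
singular values below. -/
lemma exists_isContraction_frobInner_eq (X : Matrix (Fin m) (Fin n) ℝ) :
    ∃ K : Matrix (Fin m) (Fin n) ℝ, IsContraction K ∧ frobInner K X = nuclearNorm X := by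
  obtain ⟨r, U, V, s, hU, hV, hs, hX, hsum⟩ := exists_thin_svd X
  refine ⟨U * Matrix.diagonal (fun _ => 1) * V.transpose,
    isContraction_mul_diagonal_mul hU hV (fun _ => zero_le_one) fun _ => le_rfl, ?_⟩
  rw [← hsum]
  conv_lhs => rw [hX]
  rw [frobInner_diagonal_diagonal hU hV]
  simp

lemma nuclearNorm_combo_le (X Y : Matrix (Fin m) (Fin n) ℝ) {a b : ℝ} (ha : 0 ≤ a) (hb : 0 ≤ b) :
    nuclearNorm (a • X + b • Y) ≤ a * nuclearNorm X + b * nuclearNorm Y := by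
  obtain ⟨K, hK, h⟩ := exists_isContraction_frobInner_eq (a • X + b • Y)
  rw [← h, frobInner_add_right, frobInner_smul_right, frobInner_smul_right]
  gcongr <;> exact hK.frobInner_le_nuclearNorm _

lemma abs_apply_le_nuclearNorm (X : Matrix (Fin m) (Fin n) ℝ) (i : Fin m) (j : Fin n) :
    |X i j| ≤ nuclearNorm X := by
  have h : ∀ c : ℝ, |c| = 1 → c * X i j ≤ nuclearNorm X := fun c hc => by
    refine le_of_eq_of_le ?_ ((isContraction_single i j hc).frobInner_le_nuclearNorm X)
    simp [frobInner, Matrix.single_apply, Finset.sum_ite_eq, ite_and]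
  rw [abs_le]
  have h1 := h 1 (by simp)
  have h2 := h (-1) (by simp)
  constructor <;> linarith

lemma nuclearNorm_nonneg (X : Matrix (Fin m) (Fin n) ℝ) : 0 ≤ nuclearNorm X :=
  Finset.sum_nonneg fun _ _ => LinearMap.singularValues_nonneg _ _

lemma l1Norm_nonneg (X : Matrix (Fin m) (Fin n) ℝ) : 0 ≤ l1Norm X :=
  Finset.sum_nonneg fun _ _ => Finset.sum_nonneg fun _ _ => abs_nonneg _

lemma abs_apply_le_l1Norm (X : Matrix (Fin m) (Fin n) ℝ) (i : Fin m) (j : Fin n) :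
    |X i j| ≤ l1Norm X :=
  (Finset.single_le_sum (f := fun j => |X i j|) (fun _ _ => abs_nonneg _)
    (Finset.mem_univ j)).trans
  (Finset.single_le_sum (f := fun i => ∑ j, |X i j|)
    (fun _ _ => Finset.sum_nonneg fun _ _ => abs_nonneg _) (Finset.mem_univ i))

lemma l1Norm_combo_le (X Y : Matrix (Fin m) (Fin n) ℝ) {a b : ℝ} (ha : 0 ≤ a) (hb : 0 ≤ b) :
    l1Norm (a • X + b • Y) ≤ a * l1Norm X + b * l1Norm Y := by
  simp only [l1Norm, Finset.mul_sum, ← Finset.sum_add_distrib]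
  refine Finset.sum_le_sum fun i _ => Finset.sum_le_sum fun j _ => ?_
  simp only [Matrix.add_apply, Matrix.smul_apply, smul_eq_mul]
  refine (abs_add_le _ _).trans_eq ?_
  rw [abs_mul, abs_mul, abs_of_nonneg ha, abs_of_nonneg hb]

lemma nuclearNorm_le_l1Norm (X : Matrix (Fin m) (Fin n) ℝ) : nuclearNorm X ≤ l1Norm X := by
  obtain ⟨K, hK, h⟩ := exists_isContraction_frobInner_eq X
  rw [← h]
  refine Finset.sum_le_sum fun i _ => Finset.sum_le_sum fun j _ => ?_
  calc K i j * X i j ≤ |K i j * X i j| := le_abs_self _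
    _ = |K i j| * |X i j| := abs_mul _ _
    _ ≤ |X i j| := mul_le_of_le_one_left (abs_nonneg _) (hK.abs_apply_le_one i j)

lemma continuous_l1Norm : Continuous (l1Norm : Matrix (Fin m) (Fin n) ℝ → ℝ) := by
  unfold l1Norm
  fun_prop

lemma nuclearNorm_sub_le_l1Norm (X Y : Matrix (Fin m) (Fin n) ℝ) :
    nuclearNorm X - nuclearNorm Y ≤ l1Norm (X - Y) := by
  have h := nuclearNorm_combo_le Y (X - Y) zero_le_one zero_le_one
  rw [one_smul, one_smul, add_sub_cancel] at h
  linarith [nuclearNorm_le_l1Norm (X - Y)]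

/-- Subadditivity and domination by the entrywise norm make the nuclear norm 1-Lipschitz for
`l1Norm`. -/
lemma continuous_nuclearNorm : Continuous (nuclearNorm : Matrix (Fin m) (Fin n) ℝ → ℝ) := by
  rw [continuous_iff_continuousAt]
  intro X
  rw [ContinuousAt, tendsto_iff_dist_tendsto_zero]
  have hsymm : ∀ Y : Matrix (Fin m) (Fin n) ℝ, l1Norm (X - Y) = l1Norm (Y - X) := fun Y => by
    simp only [l1Norm, Matrix.sub_apply, abs_sub_comm]
  have hlim : Tendsto (fun Y : Matrix (Fin m) (Fin n) ℝ => l1Norm (Y - X)) (𝓝 X) (𝓝 0) := by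
    have := (continuous_l1Norm.comp (continuous_id.sub continuous_const) :
      Continuous fun Y : Matrix (Fin m) (Fin n) ℝ => l1Norm (Y - X)).tendsto X
    have h0 : l1Norm (X - X) = 0 := by simp [l1Norm]
    simpa only [Function.comp_def, h0] using this
  refine squeeze_zero (fun _ => dist_nonneg) (fun Y => ?_) hlim
  rw [Real.dist_eq, abs_le]
  constructor
  · linarith [nuclearNorm_sub_le_l1Norm X Y, hsymm Y]
  · exact nuclearNorm_sub_le_l1Norm Y X

end NuclearNorm

/-! ### Proximal inequalities for the `L`, `S` and `μ` updates -/

section Shrinkage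

lemma shrink_of_nonneg {θ x : ℝ} (hθ : 0 ≤ θ) (hx : 0 ≤ x) : shrink θ x = max (x - θ) 0 := by
  unfold shrink
  rcases hx.eq_or_lt with rfl | hx
  · simp [hθ]
  · rw [Real.sign_of_pos hx, abs_of_pos hx, one_mul]

lemma shrink_neg (θ x : ℝ) : shrink θ (-x) = -shrink θ x := by
  simp [shrink, Real.sign_neg]

/-- This says that `x - shrink θ x` is a subgradient of `θ |·|` at `shrink θ x`; oddness reduces it
to `x ≥ 0`. -/
lemma shrink_prox {θ : ℝ} (hθ : 0 ≤ θ) (x z : ℝ) :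
    θ * |shrink θ x| + (x - shrink θ x) * (z - shrink θ x) ≤ θ * |z| := by
  wlog hx : 0 ≤ x generalizing x z
  · have := this (-x) (-z) (by linarith)
    rw [shrink_neg, abs_neg, abs_neg] at this
    linarith
  rw [shrink_of_nonneg hθ hx]
  rcases le_total (x - θ) 0 with h | h
  · rw [max_eq_right h]
    simp only [abs_zero, mul_zero, sub_zero, zero_add]
    calc x * z ≤ x * |z| := by gcongr; exact le_abs_self z
      _ ≤ θ * |z| := by gcongr; linarith
  · rw [max_eq_left h, abs_of_nonneg h]
    nlinarith [mul_le_mul_of_nonneg_left (le_abs_self z) hθ]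

lemma l1Norm_prox {m n : ℕ} {θ : ℝ} (hθ : 0 ≤ θ) (X W : Matrix (Fin m) (Fin n) ℝ) :
    θ * l1Norm (X.map (shrink θ)) + frobInner (X - X.map (shrink θ)) (W - X.map (shrink θ))
      ≤ θ * l1Norm W := by
  simp only [l1Norm, frobInner, Finset.mul_sum, ← Finset.sum_add_distrib]
  exact Finset.sum_le_sum fun i _ => Finset.sum_le_sum fun j _ => shrink_prox hθ _ _

lemma max_zero_prox {p q : Type*} [Fintype p] [Fintype q] (X W : Matrix p q ℝ)
    (hW : ∀ i j, 0 ≤ W i j) :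
    frobInner (X - X.map (fun x => max x 0)) (W - X.map (fun x => max x 0)) ≤ 0 := by
  refine Finset.sum_nonpos fun i _ => Finset.sum_nonpos fun j _ => ?_
  simp only [Matrix.sub_apply, Matrix.map_apply]
  rcases le_total (X i j) 0 with h | h
  · rw [max_eq_right h]
    simpa using mul_nonpos_of_nonpos_of_nonneg h (hW i j)
  · simp [max_eq_left h]

variable {m n : ℕ}

lemma IsSingularThreshold.prox {θ : ℝ} (hθ : 0 < θ) {X D : Matrix (Fin m) (Fin n) ℝ}
    (h : IsSingularThreshold θ X D) (W : Matrix (Fin m) (Fin n) ℝ) :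
    θ * nuclearNorm D + frobInner (X - D) (W - D) ≤ θ * nuclearNorm W := by
  obtain ⟨r, U, V, s, hU, hV, hs, hX, hD⟩ := h
  have hsh : ∀ i, shrink θ (s i) = max (s i - θ) 0 := fun i => shrink_of_nonneg hθ.le (hs i)
  simp only [hsh] at hD
  -- Since `s - max (s - θ) 0 = θ min (s / θ) 1`, the matrix `K` below is the required subgradient:
  -- a contraction with `X - D = θ K`.
  set w : Fin r → ℝ := fun i => min (s i / θ) 1
  set K := U * Matrix.diagonal w * V.transpose with hK
  have hKc : IsContraction K := isContraction_mul_diagonal_mul hU hV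
    (fun i => le_min (div_nonneg (hs i) hθ.le) zero_le_one) fun i => min_le_right _ _
  have hXD : X - D = θ • K := by
    rw [hX, hD, hK, ← Matrix.sub_mul, ← Matrix.mul_sub, Matrix.diagonal_sub, ← Matrix.smul_mul,
      ← Matrix.mul_smul, ← Matrix.diagonal_smul]
    congr 3
    ext i
    simp only [w, Pi.smul_apply, smul_eq_mul]
    rcases le_total (s i) θ with h | h
    · rw [max_eq_right (by linarith), min_eq_left ((div_le_one hθ).2 h)]
      field_simp
      ring
    · rw [max_eq_left (by linarith), min_eq_right ((one_le_div hθ).2 h)]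
      ring
  -- The diagonal of `D` is nonzero only where `w = 1`, so `⟨K, D⟩` is its full sum, and that sum
  -- bounds every pairing of `D` with a contraction.
  have hle : nuclearNorm D ≤ frobInner K D := by
    obtain ⟨K', hK', hD'⟩ := exists_isContraction_frobInner_eq D
    rw [← hD']
    rw [hD]
    refine (hK'.frobInner_le_sum hU hV fun i => le_max_right _ _).trans_eq ?_
    rw [frobInner_diagonal_diagonal hU hV]
    refine Finset.sum_congr rfl fun i _ => ?_
    simp only [w]
    rcases le_total (s i) θ with h | h
    · rw [max_eq_right (by linarith), zero_mul]
    · rw [min_eq_right ((one_le_div hθ).2 h), mul_one]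
  rw [hXD, frobInner_smul_left, ← mul_add, frobInner_sub_right]
  gcongr
  linarith [hKc.frobInner_le_nuclearNorm W]

lemma exists_isSingularThreshold (θ : ℝ) (X : Matrix (Fin m) (Fin n) ℝ) :
    ∃ D, IsSingularThreshold θ X D := by
  obtain ⟨r, U, V, s, hU, hV, hs, hX, -⟩ := exists_thin_svd X
  exact ⟨_, r, U, V, s, hU, hV, hs, hX, rfl⟩

end Shrinkage

/-! ### Projection onto the semidefinite cone -/

section PosPart

variable {p : Type*} [Fintype p] [DecidableEq p]

lemma posSemidef_mul_diagonal_mul (Q : Matrix p p ℝ) {d : p → ℝ} (hd : ∀ i, 0 ≤ d i) :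
    (Q * Matrix.diagonal d * Q.transpose).PosSemidef := by
  simpa using (Matrix.PosSemidef.diagonal (n := p) (d := d) hd).mul_mul_conjTranspose_same Q

lemma frobInner_mul_diagonal_mul_nonneg (Q : Matrix p p ℝ) {d : p → ℝ} (hd : ∀ i, 0 ≤ d i)
    {P : Matrix p p ℝ} (hP : P.PosSemidef) :
    0 ≤ frobInner (Q * Matrix.diagonal d * Q.transpose) P := by
  rw [frobInner_comm, frobInner_mul_diagonal_mul]
  have := hP.conjTranspose_mul_mul_same Q
  exact Finset.sum_nonneg fun i _ => mul_nonneg (hd i) (by simpa using this.diag_nonneg (i := i))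

lemma IsPosPart.posSemidef {W Z : Matrix p p ℝ} (h : IsPosPart W Z) : Z.PosSemidef := by
  obtain ⟨Q, d, -, -, rfl⟩ := h
  exact posSemidef_mul_diagonal_mul Q fun i => le_max_right _ _

lemma IsPosPart.isSymm {W Z : Matrix p p ℝ} (h : IsPosPart W Z) : W.IsSymm := by
  obtain ⟨Q, d, -, rfl, -⟩ := h
  simp [Matrix.IsSymm, Matrix.mul_assoc]

/-- Moreau decomposition: `Z - W` is the negative part of `W`, semidefinite and orthogonal to `Z`.
-/
lemma IsPosPart.frobInner_nonneg {W Z : Matrix p p ℝ} (h : IsPosPart W Z)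
    {P : Matrix p p ℝ} (hP : P.PosSemidef) : 0 ≤ frobInner (Z - W) (P - Z) := by
  obtain ⟨Q, d, hQ, hW, hZ⟩ := h
  have hZW : Z - W = Q * Matrix.diagonal (fun i => max (d i) 0 - d i) * Q.transpose := by
    rw [hZ, hW, ← Matrix.sub_mul, ← Matrix.mul_sub, Matrix.diagonal_sub]
  have h0 : frobInner (Z - W) Z = 0 := by
    rw [hZW, hZ, frobInner_diagonal_diagonal hQ hQ]
    refine Finset.sum_eq_zero fun i _ => ?_
    rcases le_total (d i) 0 with h | h
    · rw [max_eq_right h, zero_mul]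
    · rw [max_eq_left h, sub_self, mul_zero]
  rw [frobInner_sub_right, h0, sub_zero, hZW]
  exact frobInner_mul_diagonal_mul_nonneg Q (fun i => by linarith [le_max_left (d i) 0]) hP

lemma exists_isPosPart {W : Matrix p p ℝ} (hW : W.IsSymm) : ∃ Z, IsPosPart W Z := by
  have hH : W.IsHermitian := by rwa [Matrix.IsHermitian, Matrix.conjTranspose_eq_transpose_of_trivial]
  refine ⟨_, (hH.eigenvectorUnitary : Matrix p p ℝ), hH.eigenvalues, ?_, ?_, rfl⟩
  · have := Unitary.coe_star_mul_self hH.eigenvectorUnitary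
    rwa [Matrix.star_eq_conjTranspose, Matrix.conjTranspose_eq_transpose_of_trivial] at this
  · have := hH.spectral_theorem
    rw [Unitary.conjStarAlgAut_apply, Matrix.star_eq_conjTranspose,
      Matrix.conjTranspose_eq_transpose_of_trivial] at this
    exact this

end PosPart

/-! ### Matrices as Euclidean vectors -/

section Vectorization

variable {p q : Type*} [Fintype p] [Fintype q]

lemma frobNorm_sq (X : Matrix p q ℝ) : frobNorm X ^ 2 = frobInner X X := by
  unfold frobNorm frobInner
  refine (Real.sq_sqrt (Finset.sum_nonneg fun i _ => Finset.sum_nonneg fun j _ =>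
    sq_nonneg (X i j))).trans ?_
  simp only [sq]

lemma frobNorm_nonneg (X : Matrix p q ℝ) : 0 ≤ frobNorm X := Real.sqrt_nonneg _

/-- The matrices as vectors of a Euclidean space. -/
def vec : Matrix p q ℝ ≃ₗ[ℝ] EuclideanSpace ℝ (p × q) where
  toFun X := WithLp.toLp 2 fun x => X x.1 x.2
  invFun v := Matrix.of fun i j => v (i, j)
  map_add' _ _ := rfl
  map_smul' _ _ := rfl
  left_inv _ := rfl
  right_inv _ := rfl

lemma inner_vec (X Y : Matrix p q ℝ) : inner ℝ (vec X) (vec Y) = frobInner X Y := by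
  rw [PiLp.inner_apply, Fintype.sum_prod_type, frobInner]
  exact Finset.sum_congr rfl fun i _ => Finset.sum_congr rfl fun j _ => mul_comm _ _

lemma norm_vec (X : Matrix p q ℝ) : ‖vec X‖ = frobNorm X := by
  rw [← sq_eq_sq₀ (norm_nonneg _) (frobNorm_nonneg X), frobNorm_sq, ← inner_vec,
    real_inner_self_eq_norm_sq]

lemma continuous_vec_symm : Continuous (vec.symm : EuclideanSpace ℝ (p × q) → Matrix p q ℝ) :=
  LinearMap.continuous_of_finiteDimensional (vec (p := p) (q := q)).symm.toLinearMap

end Vectorization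

/-! ### Positive definite quadratic forms without symmetry -/

section QuadraticForm

variable {p : Type*} [Fintype p]

/-- The matrices, not necessarily symmetric, with positive definite quadratic form. -/
def posQuad (p : Type*) [Fintype p] : Set (Matrix p p ℝ) :=
  {W | ∀ x : p → ℝ, x ≠ 0 → 0 < x ⬝ᵥ W.mulVec x}

/-- Positivity on the compact unit sphere persists for nearby matrices, and homogeneity extends it
to all nonzero vectors. The semidefinite cone, confined to symmetric matrices, is not an open set to
separate from in the full matrix space. -/
lemma isOpen_posQuad : IsOpen (posQuad p) := by
  rw [isOpen_iff_mem_nhds]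
  intro W hW
  have hq : Continuous fun z : Matrix p p ℝ × (p → ℝ) => z.2 ⬝ᵥ z.1.mulVec z.2 := by
    fun_prop
  have h := (isCompact_sphere (0 : p → ℝ) 1).eventually_forall_of_forall_eventually
    (x₀ := W) (P := fun V x => 0 < x ⬝ᵥ V.mulVec x) fun x hx => by
      have hx0 : x ≠ 0 := by
        rintro rfl
        simp at hx
      exact (isOpen_lt continuous_const hq).mem_nhds (show (W, x) ∈ _ from hW x hx0)
  filter_upwards [h] with V hV x hx
  have hn : 0 < ‖x‖ := norm_pos_iff.2 hx
  have h1 := hV (‖x‖⁻¹ • x) (by simp [norm_smul, hn.ne'])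
  rw [Matrix.mulVec_smul, smul_dotProduct, dotProduct_smul, smul_eq_mul, smul_eq_mul] at h1
  have hi : 0 < ‖x‖⁻¹ := inv_pos.2 hn
  exact pos_of_mul_pos_right (pos_of_mul_pos_right h1 hi.le) hi.le

lemma add_mem_posQuad {V W : Matrix p p ℝ} (hV : ∀ x : p → ℝ, 0 ≤ x ⬝ᵥ V.mulVec x)
    (hW : W ∈ posQuad p) : V + W ∈ posQuad p := fun x hx => by
  rw [Matrix.add_mulVec, dotProduct_add]
  exact add_pos_of_nonneg_of_pos (hV x) (hW x hx)

lemma smul_mem_posQuad {W : Matrix p p ℝ} (hW : W ∈ posQuad p) {c : ℝ} (hc : 0 < c) :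
    c • W ∈ posQuad p := fun x hx => by
  rw [Matrix.smul_mulVec, dotProduct_smul]
  exact mul_pos hc (hW x hx)

lemma one_mem_posQuad [DecidableEq p] : (1 : Matrix p p ℝ) ∈ posQuad p := fun x hx => by
  rw [Matrix.one_mulVec]
  exact (dotProduct_self_nonneg' x).lt_of_ne fun h => hx (dotProduct_self_eq_zero.1 h.symm)

lemma quad_nonneg_of_mem_posQuad {W : Matrix p p ℝ} (hW : W ∈ posQuad p) (x : p → ℝ) :
    0 ≤ x ⬝ᵥ W.mulVec x := by
  by_cases hx : x = 0
  · simp [hx]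
  · exact (hW x hx).le

lemma convex_posQuad : Convex ℝ (posQuad p) := by
  intro V hV W hW a b ha hb hab
  rcases hb.eq_or_lt with rfl | hb
  · rw [add_zero] at hab
    simpa [hab] using hV
  · refine add_mem_posQuad (fun x => ?_) (smul_mem_posQuad hW hb)
    rw [Matrix.smul_mulVec, dotProduct_smul]
    exact mul_nonneg ha (quad_nonneg_of_mem_posQuad hV x)

lemma le_of_forall_pos_le_add_mul {r a b : ℝ} (h : ∀ ε > 0, r ≤ a + ε * b) : r ≤ a := by
  have hl : Tendsto (fun ε : ℝ => a + ε * b) (𝓝[>] 0) (𝓝 a) := by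
    have : Tendsto (fun ε : ℝ => a + ε * b) (𝓝 0) (𝓝 (a + 0 * b)) :=
      (Continuous.tendsto (by fun_prop) 0)
    rw [zero_mul, add_zero] at this
    exact this.mono_left nhdsWithin_le_nhds
  exact ge_of_tendsto hl (eventually_mem_nhdsWithin.mono h)

lemma posSemidef_iff_isSymm_quad {W : Matrix p p ℝ} :
    W.PosSemidef ↔ W.IsSymm ∧ ∀ x : p → ℝ, 0 ≤ x ⬝ᵥ W.mulVec x := by
  rw [Matrix.posSemidef_iff_dotProduct_mulVec, Matrix.IsHermitian,
    Matrix.conjTranspose_eq_transpose_of_trivial]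
  rfl

end QuadraticForm

/-! ### The Slater point by a theorem of the alternative -/

section Slater

/-- If no nonzero nonnegative vector is in the kernel of `A`, then subtracting a suitable
nonnegative matrix from `γ AᵀA` leaves a positive definite quadratic form. -/
lemma exists_nonneg_sub_mem_posQuad {m n : ℕ} (A : Matrix (Fin m) (Fin n) ℝ) {γ : ℝ} (hγ : 0 < γ)
    (hA : ∀ x : Fin n → ℝ, (∀ j, 0 ≤ x j) → A.mulVec x = 0 → x = 0) :
    ∃ μ : Matrix (Fin n) (Fin n) ℝ, (∀ i j, 0 ≤ μ i j) ∧
      γ • (A.transpose * A) - μ ∈ posQuad (Fin n) := by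
  set T : Set (Matrix (Fin n) (Fin n) ℝ) :=
    {W | ∃ μ : Matrix (Fin n) (Fin n) ℝ, (∀ i j, 0 ≤ μ i j) ∧ W - μ ∈ posQuad (Fin n)} with hT
  by_contra hcon
  have hTo : IsOpen T := by
    have : T = ⋃ μ ∈ {μ : Matrix (Fin n) (Fin n) ℝ | ∀ i j, 0 ≤ μ i j},
        {W | W - μ ∈ posQuad (Fin n)} := by
      ext x
      simp only [T, Set.mem_iUnion, Set.mem_ofPred_eq, exists_prop]
    rw [this]
    exact isOpen_biUnion fun μ _ => isOpen_posQuad.preimage (by fun_prop)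
  have hTc : Convex ℝ T := by
    rintro V ⟨μ, hμ, hV⟩ W ⟨ν, hν, hW⟩ a b ha hb hab
    refine ⟨a • μ + b • ν, fun i j => ?_, ?_⟩
    · exact add_nonneg (mul_nonneg ha (hμ i j)) (mul_nonneg hb (hν i j))
    · have : a • V + b • W - (a • μ + b • ν) = a • (V - μ) + b • (W - ν) := by
        rw [smul_sub, smul_sub]
        abel
      rw [this]
      exact convex_posQuad hV hW ha hb hab
  obtain ⟨f, hf⟩ := geometric_hahn_banach_point_open hTc hTo (x := γ • (A.transpose * A)) hcon
  obtain ⟨X, hX⟩ : ∃ X, ∀ W, f W = frobInner X W := by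
    refine ⟨Matrix.of fun i j => f (Matrix.single i j 1), fun W => ?_⟩
    conv_lhs => rw [Matrix.matrix_eq_sum_single W]
    simp only [map_sum, frobInner, Matrix.of_apply]
    refine Finset.sum_congr rfl fun i _ => Finset.sum_congr rfl fun j _ => ?_
    rw [mul_comm, ← smul_eq_mul, ← map_smul, Matrix.smul_single, smul_eq_mul, mul_one]
  set a := f (γ • (A.transpose * A)) with ha
  -- Adding `ε • 1` moves `V + μ` into `T`, so the separation can be tested on merely semidefinite
  -- `V`.
  have hcone : ∀ V μ : Matrix (Fin n) (Fin n) ℝ, (∀ x : Fin n → ℝ, 0 ≤ x ⬝ᵥ V.mulVec x) →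
      (∀ i j, 0 ≤ μ i j) → ∀ ε > 0, a < f (V + μ) + ε * f 1 := by
    intro V μ hV hμ ε hε
    rw [← smul_eq_mul, ← map_smul, ← map_add]
    refine hf _ ⟨μ, hμ, ?_⟩
    have : V + μ + ε • (1 : Matrix (Fin n) (Fin n) ℝ) - μ
      = V + ε • (1 : Matrix (Fin n) (Fin n) ℝ) := by abel
    rw [this]
    exact add_mem_posQuad hV (smul_mem_posQuad one_mem_posQuad hε)
  have hzero : ∀ x : Fin n → ℝ, 0 ≤ x ⬝ᵥ (0 : Matrix (Fin n) (Fin n) ℝ).mulVec x := by simp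
  have hzero' : ∀ i j, 0 ≤ (0 : Matrix (Fin n) (Fin n) ℝ) i j := by simp
  have hA0 : a ≤ 0 := by
    refine le_of_forall_pos_le_add_mul (b := f 1) fun ε hε => ?_
    simpa only [add_zero, map_zero] using (hcone 0 0 hzero hzero' ε hε).le
  have hpos : ∀ V μ : Matrix (Fin n) (Fin n) ℝ, (∀ x : Fin n → ℝ, 0 ≤ x ⬝ᵥ V.mulVec x) →
      (∀ i j, 0 ≤ μ i j) → 0 ≤ f (V + μ) := by
    intro V μ hV hμ
    by_contra hneg
    push Not at hneg
    -- A functional bounded below on a cone is nonnegative there: this scaling would give `t * f (V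
    -- + μ) = a - 1 < a`.
    set t := (1 - a) / -f (V + μ) with htdef
    have ht : 0 < t := div_pos (by linarith) (by linarith)
    have hlt : a ≤ t * f (V + μ) := by
      refine le_of_forall_pos_le_add_mul (b := f 1) fun ε hε => ?_
      have := (hcone (t • V) (t • μ) (fun x => by
        rw [Matrix.smul_mulVec, dotProduct_smul]
        exact mul_nonneg ht.le (hV x)) (fun i j => mul_nonneg ht.le (hμ i j)) ε hε).le
      rwa [← smul_add, map_smul, smul_eq_mul] at this
    have : t * f (V + μ) = -(1 - a) := by
      rw [htdef, div_neg, neg_mul, div_mul_cancel₀ _ hneg.ne]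
    linarith
  have hXnn : ∀ i j, 0 ≤ X i j := fun i j => by
    have := hpos 0 (Matrix.single i j 1) hzero fun a b => by
      rw [Matrix.single_apply]; split_ifs <;> simp
    rw [zero_add, hX] at this
    simpa [frobInner, Matrix.single_apply, ite_and] using this
  have hXsymm : X.IsSymm := by
    have hle : ∀ i j, X i j ≤ X j i := fun i j => by
      -- Skew matrices have zero quadratic form, so they are admissible tests.
      have := hpos (Matrix.single j i 1 - Matrix.single i j 1) 0 (fun x => by
        rw [Matrix.sub_mulVec, dotProduct_sub]
        simp [Matrix.single_mulVec, dotProduct, Function.update_apply, mul_comm]) hzero'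
      rw [add_zero, hX, frobInner_sub_right] at this
      simpa [frobInner, Matrix.single_apply, ite_and] using this
    ext i j
    exact le_antisymm (hle j i) (hle i j)
  have hXpsd : X.PosSemidef := by
    rw [posSemidef_iff_isSymm_quad]
    refine ⟨hXsymm, fun x => ?_⟩
    have := hpos (Matrix.vecMulVec x x) 0 (fun y => by
      rw [Matrix.vecMulVec_mulVec, dotProduct_smul, MulOpposite.smul_eq_mul_unop,
        MulOpposite.unop_op, dotProduct_comm y]
      exact mul_self_nonneg _) hzero'
    rw [add_zero, hX] at this
    convert this using 1
    simp only [dotProduct, Matrix.mulVec, frobInner, Matrix.vecMulVec_apply, Finset.mul_sum]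
    exact Finset.sum_congr rfl fun i _ => Finset.sum_congr rfl fun j _ => by ring
  have hquad : ∑ i, A i ⬝ᵥ X.mulVec (A i) ≤ 0 := by
    rw [ha, map_smul, hX, smul_eq_mul] at hA0
    have h1 : frobInner X (A.transpose * A) = ∑ i, A i ⬝ᵥ X.mulVec (A i) := by
      have h2 := frobInner_mul_diagonal_mul X A.transpose A.transpose (fun _ => (1 : ℝ))
      rw [Matrix.diagonal_one, Matrix.mul_one, Matrix.transpose_transpose] at h2
      rw [h2]
      refine Finset.sum_congr rfl fun i _ => ?_
      rw [one_mul, Matrix.mul_assoc]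
      rfl
    rw [← h1]
    exact nonpos_of_mul_nonpos_right hA0 hγ
  have hXA : ∀ i, X.mulVec (A i) = 0 := by
    have hnn : ∀ i, 0 ≤ A i ⬝ᵥ X.mulVec (A i) := fun i => hXpsd.dotProduct_mulVec_nonneg (A i)
    have h0 := (Finset.sum_eq_zero_iff_of_nonneg fun i _ => hnn i).1
      (le_antisymm hquad (Finset.sum_nonneg fun i _ => hnn i))
    exact fun i => (hXpsd.dotProduct_mulVec_zero_iff (A i)).1 (h0 i (Finset.mem_univ i))
  -- Each row of `X` is nonnegative and, by symmetry of `X`, killed by `A`; this is where `hA`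
  -- enters.
  have hX0 : X = 0 := by
    ext i j
    have := hA (fun a => X j a) (fun a => hXnn j a) (by
      ext b
      have := congrFun (hXA b) j
      rw [Matrix.mulVec, dotProduct_comm] at this
      exact this)
    rw [← hXsymm.apply i j]
    exact congrFun this i
  have h1 := hcone 0 0 hzero hzero' 1 one_pos
  rw [ha, hX, hX, hX, hX0] at h1
  simp [frobInner] at h1

end Slater

/-! ### The operator `𝒢`: adjoint, norm and quadratic form -/

section BlockInner

variable {m n : ℕ}

lemma frobInner_eq_blocks (Q W : Matrix (Fin m ⊕ Fin n) (Fin m ⊕ Fin n) ℝ) :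
    frobInner Q W = frobInner Q.toBlocks₁₁ W.toBlocks₁₁ + frobInner Q.toBlocks₁₂ W.toBlocks₁₂
      + frobInner Q.toBlocks₂₁ W.toBlocks₂₁ + frobInner Q.toBlocks₂₂ W.toBlocks₂₂ := by
  simp only [frobInner, Fintype.sum_sum_type, Finset.sum_add_distrib, Matrix.toBlocks₁₁,
    Matrix.toBlocks₁₂, Matrix.toBlocks₂₁, Matrix.toBlocks₂₂, Matrix.of_apply]
  ring

lemma frobInner_opG (Q : Matrix (Fin m ⊕ Fin n) (Fin m ⊕ Fin n) ℝ)
    (L S : Matrix (Fin m) (Fin n) ℝ) (μ : Matrix (Fin n) (Fin n) ℝ) :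
    frobInner Q (opG L S μ) = frobInner (Q.toBlocks₁₂ + Q.toBlocks₂₁.transpose) (L + S)
      - frobInner Q.toBlocks₂₂ μ := by
  have h0 : frobInner Q.toBlocks₁₁ (0 : Matrix (Fin m) (Fin m) ℝ) = 0 := by simp [frobInner]
  rw [frobInner_eq_blocks, opG, Matrix.toBlocks_fromBlocks₁₁, Matrix.toBlocks_fromBlocks₁₂,
    Matrix.toBlocks_fromBlocks₂₁, Matrix.toBlocks_fromBlocks₂₂, frobInner_add_left,
    ← frobInner_transpose Q.toBlocks₂₁, Matrix.transpose_transpose, frobInner_neg_right, h0]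
  ring

lemma frobNorm_opG_sq (L S : Matrix (Fin m) (Fin n) ℝ) (μ : Matrix (Fin n) (Fin n) ℝ) :
    frobNorm (opG L S μ) ^ 2 = 2 * frobNorm (L + S) ^ 2 + frobNorm μ ^ 2 := by
  rw [frobNorm_sq, frobInner_opG, frobNorm_sq, frobNorm_sq, opG, Matrix.toBlocks_fromBlocks₁₂,
    Matrix.toBlocks_fromBlocks₂₁, Matrix.toBlocks_fromBlocks₂₂, Matrix.transpose_transpose,
    frobInner_add_left, frobInner_comm (-μ), frobInner_neg_right]
  ring

lemma frobNorm_add_sq_le {p q : Type*} [Fintype p] [Fintype q] (X Y : Matrix p q ℝ) :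
    frobNorm (X + Y) ^ 2 ≤ 2 * (frobNorm X ^ 2 + frobNorm Y ^ 2) := by
  have h : 0 ≤ frobInner (X - Y) (X - Y) := by
    rw [← frobNorm_sq]
    positivity
  simp only [frobNorm_sq, frobInner_add_left, frobInner_add_right, frobInner_sub_left,
    frobInner_sub_right] at *
  linarith

lemma frobNorm_opG_sq_le (L S : Matrix (Fin m) (Fin n) ℝ) (μ : Matrix (Fin n) (Fin n) ℝ) :
    frobNorm (opG L S μ) ^ 2 ≤ 4 * (frobNorm L ^ 2 + frobNorm S ^ 2 + frobNorm μ ^ 2) := by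
  rw [frobNorm_opG_sq]
  linarith [frobNorm_add_sq_le L S, sq_nonneg (frobNorm μ)]

theorem isLUB_frobNorm_opG (hm : 0 < m) (hn : 0 < n) :
    IsLUB {r : ℝ | ∃ (L S : Matrix (Fin m) (Fin n) ℝ) (μ : Matrix (Fin n) (Fin n) ℝ),
      frobNorm L ^ 2 + frobNorm S ^ 2 + frobNorm μ ^ 2 = 1 ∧ r = frobNorm (opG L S μ)} 2 := by
  refine IsGreatest.isLUB ⟨?_, ?_⟩
  · set L : Matrix (Fin m) (Fin n) ℝ := Matrix.single ⟨0, hm⟩ ⟨0, hn⟩ 1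
    have hL : frobInner L L = 1 := by
      simp [frobInner, L, Matrix.single_apply, ite_and]
    have h0 : frobInner (0 : Matrix (Fin n) (Fin n) ℝ) 0 = 0 := by simp [frobInner]
    have hs : √2⁻¹ * √2⁻¹ = (2⁻¹ : ℝ) := Real.mul_self_sqrt (by norm_num)
    -- Equality needs `L = S` (parallelogram law) and `μ = 0`, since the two off-diagonal blocks
    -- count `L + S` twice.
    refine ⟨√2⁻¹ • L, √2⁻¹ • L, 0, ?_, ?_⟩
    · simp only [frobNorm_sq, frobInner_smul_left, frobInner_smul_right, hL, h0]
      linarith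
    · have h : frobNorm (opG (√2⁻¹ • L) (√2⁻¹ • L) (0 : Matrix (Fin n) (Fin n) ℝ)) ^ 2 = 2 ^ 2 := by
        rw [frobNorm_opG_sq]
        simp only [frobNorm_sq, frobInner_add_left, frobInner_add_right, frobInner_smul_left,
          frobInner_smul_right, hL, h0]
        linarith
      exact ((sq_eq_sq₀ (frobNorm_nonneg _) (by norm_num)).1 h).symm
  · rintro _ ⟨L, S, μ, h, rfl⟩
    have h1 := frobNorm_opG_sq_le L S μ
    rw [h] at h1
    exact abs_le_of_sq_le_sq' (by linarith) (by norm_num) |>.2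

lemma opG_add_blockMat_zero (A : Matrix (Fin m) (Fin n) ℝ) (γ : ℝ)
    (L S : Matrix (Fin m) (Fin n) ℝ) (μ : Matrix (Fin n) (Fin n) ℝ) :
    opG L S μ + blockMat A γ 0 0 0 = blockMat A γ L S μ := by
  rw [opG, blockMat, blockMat, Matrix.fromBlocks_add, zero_add, zero_add, zero_sub, sub_zero,
    ← Matrix.transpose_add, ← sub_eq_add_neg, neg_add_eq_sub]

lemma isSymm_blockMat (A : Matrix (Fin m) (Fin n) ℝ) (γ : ℝ)
    (L S : Matrix (Fin m) (Fin n) ℝ) {μ : Matrix (Fin n) (Fin n) ℝ} (hμ : μ.IsSymm) :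
    (blockMat A γ L S μ).IsSymm := by
  refine Matrix.IsSymm.fromBlocks Matrix.isSymm_one rfl ?_
  have h : (A.transpose * A).IsSymm := by simp [Matrix.IsSymm, Matrix.transpose_mul]
  exact (h.smul γ).sub hμ

lemma quad_blockMat (A : Matrix (Fin m) (Fin n) ℝ) (γ : ℝ)
    (L S : Matrix (Fin m) (Fin n) ℝ) (μ : Matrix (Fin n) (Fin n) ℝ) (x : Fin m ⊕ Fin n → ℝ) :
    x ⬝ᵥ (blockMat A γ L S μ).mulVec x
      = (x ∘ Sum.inl) ⬝ᵥ (x ∘ Sum.inl)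
        + 2 * ((x ∘ Sum.inl) ⬝ᵥ (L + S - A).mulVec (x ∘ Sum.inr))
        + (x ∘ Sum.inr) ⬝ᵥ (γ • (A.transpose * A) - μ).mulVec (x ∘ Sum.inr) := by
  rw [blockMat, Matrix.fromBlocks_mulVec]
  conv_lhs => rw [← Sum.elim_comp_inl_inr x]
  rw [sumElim_dotProduct_sumElim, Sum.elim_comp_inl, Sum.elim_comp_inr, dotProduct_add,
    dotProduct_add, Matrix.one_mulVec, Matrix.dotProduct_mulVec (x ∘ Sum.inr) (Matrix.transpose _),
    Matrix.vecMul_transpose, dotProduct_comm ((L + S - A).mulVec _)]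
  ring

end BlockInner

/-! ### The unknowns `(L, S, μ)` as one matrix -/

section Stack

variable {m n : ℕ}

/-- The unknowns `(L, S, μ)` stacked into one matrix. -/
def stack (L S : Matrix (Fin m) (Fin n) ℝ) (μ : Matrix (Fin n) (Fin n) ℝ) :
    Matrix (Fin m ⊕ Fin m ⊕ Fin n) (Fin n) ℝ :=
  Matrix.fromRows L (Matrix.fromRows S μ)

/-- The first block of a stacked matrix. -/
def lPart (y : Matrix (Fin m ⊕ Fin m ⊕ Fin n) (Fin n) ℝ) : Matrix (Fin m) (Fin n) ℝ :=
  Matrix.of fun i j => y (Sum.inl i) j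

/-- The second block of a stacked matrix. -/
def sPart (y : Matrix (Fin m ⊕ Fin m ⊕ Fin n) (Fin n) ℝ) : Matrix (Fin m) (Fin n) ℝ :=
  Matrix.of fun i j => y (Sum.inr (Sum.inl i)) j

/-- The third block of a stacked matrix. -/
def muPart (y : Matrix (Fin m ⊕ Fin m ⊕ Fin n) (Fin n) ℝ) : Matrix (Fin n) (Fin n) ℝ :=
  Matrix.of fun i j => y (Sum.inr (Sum.inr i)) j

@[simp] lemma lPart_stack (L S : Matrix (Fin m) (Fin n) ℝ) (μ : Matrix (Fin n) (Fin n) ℝ) :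
    lPart (stack L S μ) = L := rfl

@[simp] lemma sPart_stack (L S : Matrix (Fin m) (Fin n) ℝ) (μ : Matrix (Fin n) (Fin n) ℝ) :
    sPart (stack L S μ) = S := rfl

@[simp] lemma muPart_stack (L S : Matrix (Fin m) (Fin n) ℝ) (μ : Matrix (Fin n) (Fin n) ℝ) :
    muPart (stack L S μ) = μ := rfl

lemma stack_sub (L S L' S' : Matrix (Fin m) (Fin n) ℝ) (μ μ' : Matrix (Fin n) (Fin n) ℝ) :
    stack L S μ - stack L' S' μ' = stack (L - L') (S - S') (μ - μ') := by
  ext (i | i | i) j <;> rfl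

lemma frobInner_eq_parts (x y : Matrix (Fin m ⊕ Fin m ⊕ Fin n) (Fin n) ℝ) :
    frobInner x y = frobInner (lPart x) (lPart y) + frobInner (sPart x) (sPart y)
      + frobInner (muPart x) (muPart y) := by
  simp only [frobInner, Fintype.sum_sum_type, lPart, sPart, muPart, Matrix.of_apply, add_assoc]

lemma frobNorm_stack_sq (L S : Matrix (Fin m) (Fin n) ℝ) (μ : Matrix (Fin n) (Fin n) ℝ) :
    frobNorm (stack L S μ) ^ 2 = frobNorm L ^ 2 + frobNorm S ^ 2 + frobNorm μ ^ 2 := by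
  simp only [frobNorm_sq, frobInner_eq_parts, lPart_stack, sPart_stack, muPart_stack]

lemma avg_stack (L S : ℕ → Matrix (Fin m) (Fin n) ℝ) (μ : ℕ → Matrix (Fin n) (Fin n) ℝ) (k : ℕ) :
    avg (fun k => stack (L k) (S k) (μ k)) k = stack (avg L k) (avg S k) (avg μ k) := by
  ext (i | i | i) j <;> simp [avg, stack, Matrix.sum_apply]

lemma continuous_lPart : Continuous (lPart (m := m) (n := n)) :=
  continuous_matrix fun _ _ => continuous_id.matrix_elem _ _

lemma continuous_sPart : Continuous (sPart (m := m) (n := n)) :=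
  continuous_matrix fun _ _ => continuous_id.matrix_elem _ _

lemma continuous_muPart : Continuous (muPart (m := m) (n := n)) :=
  continuous_matrix fun _ _ => continuous_id.matrix_elem _ _

/-- The operator `𝒢` on stacked unknowns. -/
def opGStack (m n : ℕ) : Matrix (Fin m ⊕ Fin m ⊕ Fin n) (Fin n) ℝ →ₗ[ℝ]
    Matrix (Fin m ⊕ Fin n) (Fin m ⊕ Fin n) ℝ where
  toFun y := opG (lPart y) (sPart y) (muPart y)
  map_add' x y := by
    ext (i | i) (j | j) <;> simp [opG, lPart, sPart, muPart] <;> ring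
  map_smul' a y := by
    ext (i | i) (j | j) <;> simp [opG, lPart, sPart, muPart] <;> ring

/-- The objective on stacked unknowns. -/
def objectiveStack (lam : ℝ) (y : Matrix (Fin m ⊕ Fin m ⊕ Fin n) (Fin n) ℝ) : ℝ :=
  objective lam (lPart y) (sPart y)

/-- The stacked unknowns with entrywise nonnegative `μ`. -/
def nonnegStack (m n : ℕ) : Set (Matrix (Fin m ⊕ Fin m ⊕ Fin n) (Fin n) ℝ) :=
  {y | ∀ i j, 0 ≤ muPart y i j}

/-- The constraint matrix on stacked unknowns. -/
def blockStack (A : Matrix (Fin m) (Fin n) ℝ) (γ : ℝ)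
    (y : Matrix (Fin m ⊕ Fin m ⊕ Fin n) (Fin n) ℝ) : Matrix (Fin m ⊕ Fin n) (Fin m ⊕ Fin n) ℝ :=
  blockMat A γ (lPart y) (sPart y) (muPart y)

lemma continuous_objectiveStack (lam : ℝ) :
    Continuous (objectiveStack lam : Matrix (Fin m ⊕ Fin m ⊕ Fin n) (Fin n) ℝ → ℝ) :=
  (continuous_nuclearNorm.comp continuous_lPart).add
    ((continuous_l1Norm.comp continuous_sPart).const_mul lam)

lemma isClosed_nonnegStack : IsClosed (nonnegStack m n) := by
  simp only [nonnegStack, Set.ofPred_forall]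
  exact isClosed_iInter fun i => isClosed_iInter fun j =>
    isClosed_le continuous_const (continuous_muPart.matrix_elem i j)

lemma isClosed_posSemidef {p : Type*} [Fintype p] :
    IsClosed {W : Matrix p p ℝ | W.PosSemidef} := by
  simp only [posSemidef_iff_isSymm_quad, Set.ofPred_and, Set.ofPred_forall]
  refine IsClosed.inter (isClosed_eq (by fun_prop) continuous_id) (isClosed_iInter fun x => ?_)
  exact isClosed_le continuous_const (by fun_prop)

lemma convex_posSemidef {p : Type*} [Fintype p] :
    Convex ℝ {W : Matrix p p ℝ | W.PosSemidef} :=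
  fun _ hV _ hW _ _ ha hb _ => (hV.smul ha).add (hW.smul hb)

lemma continuous_blockStack (A : Matrix (Fin m) (Fin n) ℝ) (γ : ℝ) :
    Continuous (blockStack A γ) := by
  unfold blockStack blockMat
  have h1 := continuous_lPart (m := m) (n := n)
  have h2 := continuous_sPart (m := m) (n := n)
  have h3 := continuous_muPart (m := m) (n := n)
  exact Continuous.matrix_fromBlocks (by fun_prop) (by fun_prop) (by fun_prop) (by fun_prop)

lemma convexOn_objectiveStack {lam : ℝ} (hlam : 0 ≤ lam) :
    ConvexOn ℝ (nonnegStack m n) (objectiveStack lam) := by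
  refine ⟨fun x hx y hy a b ha hb _ i j => ?_, fun x _ y _ a b ha hb _ => ?_⟩
  · exact add_nonneg (mul_nonneg ha (hx i j)) (mul_nonneg hb (hy i j))
  · have h1 := nuclearNorm_combo_le (lPart x) (lPart y) ha hb
    have h2 := mul_le_mul_of_nonneg_left (l1Norm_combo_le (sPart x) (sPart y) ha hb) hlam
    have e1 : lPart (a • x + b • y) = a • lPart x + b • lPart y := rfl
    have e2 : sPart (a • x + b • y) = a • sPart x + b • sPart y := rfl
    simp only [objectiveStack, objective, smul_eq_mul, e1, e2]
    linarith

lemma opGStack_add (A : Matrix (Fin m) (Fin n) ℝ) (γ : ℝ)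
    (y : Matrix (Fin m ⊕ Fin m ⊕ Fin n) (Fin n) ℝ) :
    opGStack m n y + blockMat A γ 0 0 0 = blockStack A γ y :=
  opG_add_blockMat_zero A γ _ _ _

lemma frobNorm_opGStack_le (y : Matrix (Fin m ⊕ Fin m ⊕ Fin n) (Fin n) ℝ) :
    frobNorm (opGStack m n y) ≤ 2 * frobNorm y := by
  refine (abs_le_of_sq_le_sq' ?_ (mul_nonneg zero_le_two (frobNorm_nonneg y))).2
  have h1 := frobNorm_opG_sq_le (lPart y) (sPart y) (muPart y)
  have h2 : frobNorm y ^ 2 = frobNorm (lPart y) ^ 2 + frobNorm (sPart y) ^ 2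
      + frobNorm (muPart y) ^ 2 := by
    simp only [frobNorm_sq, frobInner_eq_parts y y]
  rw [mul_pow, h2]
  have h3 : opGStack m n y = opG (lPart y) (sPart y) (muPart y) := rfl
  rw [h3]
  linarith

end Stack

/-! ### Existence of a minimizer and of a saddle point -/

section Existence

variable {m n : ℕ}

/-- Testing semidefiniteness on the vector (0, 1, …, 1) bounds the nonnegative `μ`, which the
objective does not control. -/
lemma sum_le_of_posSemidef_blockStack {A : Matrix (Fin m) (Fin n) ℝ} {γ : ℝ}
    {y : Matrix (Fin m ⊕ Fin m ⊕ Fin n) (Fin n) ℝ} (hy : (blockStack A γ y).PosSemidef) :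
    ∑ i, ∑ j, muPart y i j ≤ ∑ i, ∑ j, (γ • (A.transpose * A)) i j := by
  have h := (posSemidef_iff_isSymm_quad.1 hy).2 (Sum.elim 0 1)
  rw [blockStack, quad_blockMat, Sum.elim_comp_inl, Sum.elim_comp_inr] at h
  simp only [zero_dotProduct, Matrix.sub_mulVec, dotProduct_sub] at h
  have e : ∀ W : Matrix (Fin n) (Fin n) ℝ, 1 ⬝ᵥ W.mulVec 1 = ∑ i, ∑ j, W i j := fun W => by
    simp [dotProduct, Matrix.mulVec]
  rw [e, e] at h
  linarith

/-- The problem has an optimal solution. -/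
lemma exists_minimizer (A : Matrix (Fin m) (Fin n) ℝ) {γ lam : ℝ} (hγ : 0 < γ) (hlam : 0 < lam) :
    ∃ y ∈ nonnegStack m n, (blockStack A γ y).PosSemidef ∧
      ∀ w ∈ nonnegStack m n, (blockStack A γ w).PosSemidef →
        objectiveStack lam y ≤ objectiveStack lam w := by
  -- `R` is the objective at the feasible point `(A, 0, 0)`, so minimizing over this sublevel set
  -- loses nothing.
  set R := nuclearNorm A
  set D : Set (Matrix (Fin m ⊕ Fin m ⊕ Fin n) (Fin n) ℝ) :=
    {y | y ∈ nonnegStack m n ∧ (blockStack A γ y).PosSemidef ∧ objectiveStack lam y ≤ R} with hD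
  have hy₀ : stack A 0 0 ∈ D := by
    refine ⟨fun i j => le_rfl, posSemidef_iff_isSymm_quad.2 ⟨?_, fun x => ?_⟩, ?_⟩
    · exact isSymm_blockMat A γ _ _ Matrix.isSymm_zero
    · rw [blockStack, quad_blockMat]
      simp only [lPart_stack, sPart_stack, muPart_stack, add_zero, sub_self, Matrix.zero_mulVec,
        dotProduct_zero, mul_zero, sub_zero]
      refine add_nonneg (dotProduct_self_nonneg' _) ?_
      rw [Matrix.smul_mulVec, dotProduct_smul, ← Matrix.mulVec_mulVec, Matrix.dotProduct_mulVec,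
        Matrix.vecMul_transpose]
      exact mul_nonneg hγ.le (dotProduct_self_nonneg' _)
    · simp [objectiveStack, objective, l1Norm, R]
  have hclosed : IsClosed D :=
    isClosed_nonnegStack.inter ((isClosed_posSemidef.preimage (continuous_blockStack A γ)).inter
      (isClosed_le (continuous_objectiveStack lam) continuous_const))
  set M := ∑ i, ∑ j, (γ • (A.transpose * A)) i j
  set B := max R (max (R / lam) M)
  have hcompact : IsCompact D := by
    have hbox : @IsCompact (Matrix (Fin m ⊕ Fin m ⊕ Fin n) (Fin n) ℝ) _
        (Set.univ.pi fun _ => Set.univ.pi fun _ => Set.Icc (-B) B) :=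
      isCompact_univ_pi fun _ => isCompact_univ_pi fun _ => isCompact_Icc
    refine hbox.of_isClosed_subset hclosed ?_
    rintro y ⟨hy1, hy2, hy3⟩ i - j -
    rw [Set.mem_Icc, ← abs_le]
    have hn := nuclearNorm_nonneg (lPart y)
    have hs := l1Norm_nonneg (sPart y)
    have hls := mul_nonneg hlam.le hs
    unfold objectiveStack objective at hy3
    rcases i with i | i | i
    · refine (abs_apply_le_nuclearNorm (lPart y) i j).trans (le_trans ?_ (le_max_left _ _))
      linarith
    · refine (abs_apply_le_l1Norm (sPart y) i j).trans
        (le_trans ?_ ((le_max_left _ _).trans (le_max_right _ _)))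
      rw [le_div_iff₀ hlam]
      linarith
    · refine le_trans ?_ ((le_max_right _ _).trans (le_max_right _ _))
      refine le_trans ?_ (sum_le_of_posSemidef_blockStack hy2)
      have h0 : 0 ≤ muPart y i j := hy1 i j
      have : |y (Sum.inr (Sum.inr i)) j| = muPart y i j := abs_of_nonneg h0
      rw [this]
      exact (Finset.single_le_sum (f := fun j => muPart y i j) (fun j _ => hy1 i j)
        (Finset.mem_univ j)).trans
        (Finset.single_le_sum (f := fun i => ∑ j, muPart y i j)
        (fun i _ => Finset.sum_nonneg fun j _ => hy1 i j) (Finset.mem_univ i))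
  obtain ⟨y, hy, hmin⟩ := hcompact.exists_isMinOn ⟨_, hy₀⟩
    (continuous_objectiveStack lam).continuousOn
  refine ⟨y, hy.1, hy.2.1, fun w hw hw' => ?_⟩
  rcases le_total (objectiveStack lam w) R with h | h
  · exact hmin ⟨hw, hw', h⟩
  · exact hy.2.2.trans h

/-- Symmetrizing `μ` turns positivity of the quadratic form into semidefiniteness. -/
lemma le_objectiveStack_of_mem_posQuad {A : Matrix (Fin m) (Fin n) ℝ} {γ lam r : ℝ}
    (hr : ∀ w ∈ nonnegStack m n, (blockStack A γ w).PosSemidef → r ≤ objectiveStack lam w)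
    {y : Matrix (Fin m ⊕ Fin m ⊕ Fin n) (Fin n) ℝ} (hy : y ∈ nonnegStack m n)
    (hy' : blockStack A γ y ∈ posQuad (Fin m ⊕ Fin n)) : r ≤ objectiveStack lam y := by
  set ν : Matrix (Fin n) (Fin n) ℝ := (2⁻¹ : ℝ) • (muPart y + (muPart y).transpose) with hν
  have hνs : ν.IsSymm := by
    rw [hν, Matrix.IsSymm, Matrix.transpose_smul, Matrix.transpose_add, Matrix.transpose_transpose,
      add_comm]
  have hq : ∀ v : Fin n → ℝ, v ⬝ᵥ ν.mulVec v = v ⬝ᵥ (muPart y).mulVec v := fun v => by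
    rw [hν, Matrix.smul_mulVec, dotProduct_smul, Matrix.add_mulVec, dotProduct_add,
      Matrix.dotProduct_mulVec v (Matrix.transpose _), Matrix.vecMul_transpose,
      dotProduct_comm ((muPart y).mulVec v), smul_eq_mul]
    ring
  refine hr (stack (lPart y) (sPart y) ν) (fun i j => ?_)
    (posSemidef_iff_isSymm_quad.2 ⟨isSymm_blockMat A γ _ _ hνs, fun x => ?_⟩)
  · exact mul_nonneg (by norm_num) (add_nonneg (hy i j) (hy j i))
  · have h := quad_nonneg_of_mem_posQuad hy' x
    simpa only [blockStack, quad_blockMat, lPart_stack, sPart_stack, muPart_stack,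
      Matrix.sub_mulVec, dotProduct_sub, hq] using h

/-- The positive semidefinite cone in vectorized form. -/
def psdVec (m n : ℕ) : Set (EuclideanSpace ℝ ((Fin m ⊕ Fin n) × (Fin m ⊕ Fin n))) :=
  vec.symm ⁻¹' {W | W.PosSemidef}

/-- The stacked unknowns with nonnegative `μ` in vectorized form. -/
def nonnegVec (m n : ℕ) : Set (EuclideanSpace ℝ ((Fin m ⊕ Fin m ⊕ Fin n) × Fin n)) :=
  vec.symm ⁻¹' nonnegStack m n

/-- The objective in vectorized form. -/
def objectiveVec (lam : ℝ) (u : EuclideanSpace ℝ ((Fin m ⊕ Fin m ⊕ Fin n) × Fin n)) : ℝ :=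
  objectiveStack lam (vec.symm u)

/-- The operator `𝒢` in vectorized form. -/
def opGVec (m n : ℕ) : EuclideanSpace ℝ ((Fin m ⊕ Fin m ⊕ Fin n) × Fin n) →L[ℝ]
    EuclideanSpace ℝ ((Fin m ⊕ Fin n) × (Fin m ⊕ Fin n)) :=
  LinearMap.toContinuousLinearMap
    (vec.toLinearMap ∘ₗ opGStack m n ∘ₗ vec.symm.toLinearMap)

lemma opGVec_vec (y : Matrix (Fin m ⊕ Fin m ⊕ Fin n) (Fin n) ℝ) :
    opGVec m n (vec y) = vec (opGStack m n y) := rfl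

lemma opGVec_add (A : Matrix (Fin m) (Fin n) ℝ) (γ : ℝ)
    (y : Matrix (Fin m ⊕ Fin m ⊕ Fin n) (Fin n) ℝ) :
    opGVec m n (vec y) + vec (blockMat A γ 0 0 0) = vec (blockStack A γ y) := by
  rw [opGVec_vec, ← map_add, opGStack_add]

lemma vec_sub_opGVec_sub (A : Matrix (Fin m) (Fin n) ℝ) (γ : ℝ)
    (W : Matrix (Fin m ⊕ Fin n) (Fin m ⊕ Fin n) ℝ)
    (y : Matrix (Fin m ⊕ Fin m ⊕ Fin n) (Fin n) ℝ) :
    vec W - opGVec m n (vec y) - vec (blockMat A γ 0 0 0) = vec (W - blockStack A γ y) := by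
  rw [sub_sub, opGVec_add, map_sub]

lemma convexOn_objectiveVec {lam : ℝ} (hlam : 0 ≤ lam) :
    ConvexOn ℝ (nonnegVec m n) (objectiveVec lam) :=
  (convexOn_objectiveStack hlam).comp_linearMap (vec.symm.toLinearMap)

lemma norm_opGVec_le (u : EuclideanSpace ℝ ((Fin m ⊕ Fin m ⊕ Fin n) × Fin n)) :
    ‖opGVec m n u‖ ≤ 2 * ‖u‖ := by
  obtain ⟨y, rfl⟩ := vec.surjective u
  rw [opGVec_vec, norm_vec, norm_vec]
  exact frobNorm_opGStack_le y

lemma exists_isSaddle (A : Matrix (Fin m) (Fin n) ℝ) {γ lam : ℝ} (hγ : 0 < γ) (hlam : 0 < lam)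
    (hA : ∀ x : Fin n → ℝ, (∀ j, 0 ≤ x j) → A.mulVec x = 0 → x = 0) :
    ∃ u P, IsSaddle (psdVec m n) (nonnegVec m n) (objectiveVec lam) (opGVec m n)
      (vec (blockMat A γ 0 0 0)) u P := by
  obtain ⟨y, hy, hy', hmin⟩ := exists_minimizer A hγ hlam
  obtain ⟨μ, hμ, hμ'⟩ := exists_nonneg_sub_mem_posQuad A hγ hA
  have hslater : blockStack A γ (stack A 0 μ) ∈ posQuad (Fin m ⊕ Fin n) := by
    intro x hx
    rw [blockStack, quad_blockMat]
    simp only [lPart_stack, sPart_stack, muPart_stack, add_zero, sub_self, Matrix.zero_mulVec,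
      dotProduct_zero, mul_zero]
    by_cases h : x ∘ Sum.inr = 0
    · have hl : x ∘ Sum.inl ≠ 0 := fun hl => hx (by
        rw [← Sum.elim_comp_inl_inr x, hl, h]
        exact Sum.elim_zero_zero)
      have := one_mem_posQuad (p := Fin m) _ hl
      rw [Matrix.one_mulVec] at this
      simpa [h] using this
    · exact add_pos_of_nonneg_of_pos (dotProduct_self_nonneg' _) (hμ' _ h)
  have hconv : Convex ℝ (vec.symm ⁻¹' posQuad (Fin m ⊕ Fin n)) :=
    convex_posQuad.linear_preimage vec.symm.toLinearMap
  obtain ⟨P, hP⟩ := exists_multiplier (O := vec.symm ⁻¹' posQuad (Fin m ⊕ Fin n))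
    (G := opGVec m n) (c := vec (blockMat A γ 0 0 0))
    (isOpen_posQuad.preimage continuous_vec_symm) hconv (convexOn_objectiveVec hlam.le)
    (r := objectiveStack lam y) (fun v hv hv' => by
      obtain ⟨v, rfl⟩ := vec.surjective v
      rw [opGVec_add] at hv'
      exact le_objectiveStack_of_mem_posQuad hmin hv hv')
    (v₀ := vec (stack A 0 μ)) hμ (by rw [opGVec_add]; exact hslater)
  refine ⟨vec y, P, hy, ?_, fun W hW u hu => ?_⟩
  · rw [opGVec_add]
    exact hy'
  -- The multiplier inequality is known on the open set `posQuad`; it is applied to `W + ε • 1` and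
  -- `ε` tends to zero.
  · refine le_of_forall_pos_le_add_mul (b := inner ℝ P (vec 1)) fun ε hε => ?_
    obtain ⟨W, rfl⟩ := vec.surjective W
    obtain ⟨u, rfl⟩ := vec.surjective u
    have hW' : W + ε • (1 : Matrix (Fin m ⊕ Fin n) (Fin m ⊕ Fin n) ℝ) ∈ posQuad _ :=
      add_mem_posQuad (posSemidef_iff_isSymm_quad.1 hW).2 (smul_mem_posQuad one_mem_posQuad hε)
    have h := hP (vec (W + ε • 1)) hW' (vec u) hu
    rw [vec_sub_opGVec_sub, add_sub_right_comm, map_add, map_smul, inner_add_right,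
      inner_smul_right, ← add_assoc] at h
    rw [vec_sub_opGVec_sub]
    exact h

end Existence

/-! ### The concrete iteration as an instance of the abstract scheme -/

section Iteration

variable {m n : ℕ} {A : Matrix (Fin m) (Fin n) ℝ} {γ lam ρ τ : ℝ}

/-- One step of the iteration preserves symmetry of `μ` and `Y` and can always be carried out. -/
lemma exists_step (A : Matrix (Fin m) (Fin n) ℝ) (γ lam ρ τ : ℝ)
    (L S : Matrix (Fin m) (Fin n) ℝ) {μ : Matrix (Fin n) (Fin n) ℝ}
    {Y : Matrix (Fin m ⊕ Fin n) (Fin m ⊕ Fin n) ℝ} (hμ : μ.IsSymm) (hY : Y.IsSymm) :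
    ∃ Z L' S' μ' Y', IsPosPart (blockMat A γ L S μ - ρ⁻¹ • Y) Z ∧
      IsSingularThreshold (τ / ρ) (L + (2 * τ) • incr A ρ Z L S Y) L' ∧
      S' = (S + (2 * τ) • incr A ρ Z L S Y).map (shrink (τ * lam / ρ)) ∧
      μ' = (μ - τ • (Z.toBlocks₂₂ - γ • (A.transpose * A) + μ
        + ρ⁻¹ • Y.toBlocks₂₂)).map (fun x => max x 0) ∧
      Y' = Y + ρ • (Z - blockMat A γ L' S' μ') ∧ μ'.IsSymm ∧ Y'.IsSymm := by
  obtain ⟨Z, hZ⟩ := exists_isPosPart ((isSymm_blockMat A γ L S hμ).sub (hY.smul ρ⁻¹))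
  obtain ⟨L', hL'⟩ := exists_isSingularThreshold (τ / ρ) (L + (2 * τ) • incr A ρ Z L S Y)
  have hZs : Z.IsSymm := (posSemidef_iff_isSymm_quad.1 hZ.posSemidef).1
  have hblock : ∀ W : Matrix (Fin m ⊕ Fin n) (Fin m ⊕ Fin n) ℝ, W.IsSymm →
      W.toBlocks₂₂.IsSymm := fun W hW => Matrix.IsSymm.ext fun i j => hW.apply _ _
  have hAA : (A.transpose * A).IsSymm := by simp [Matrix.IsSymm, Matrix.transpose_mul]
  have hμ' : ((μ - τ • (Z.toBlocks₂₂ - γ • (A.transpose * A) + μ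
        + ρ⁻¹ • Y.toBlocks₂₂)).map (fun x => max x 0)).IsSymm :=
    (hμ.sub (((((hblock Z hZs).sub (hAA.smul γ)).add hμ).add
      ((hblock Y hY).smul ρ⁻¹)).smul τ)).map _
  exact ⟨Z, L', _, _, _, hZ, hL', rfl, rfl, rfl, hμ',
    hY.add ((hZs.sub (isSymm_blockMat A γ _ _ hμ')).smul ρ)⟩

theorem exists_isLADMM (A : Matrix (Fin m) (Fin n) ℝ) (γ lam ρ τ : ℝ)
    (Z₀ : Matrix (Fin m ⊕ Fin n) (Fin m ⊕ Fin n) ℝ) (L₀ S₀ : Matrix (Fin m) (Fin n) ℝ)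
    (μ₀ : Matrix (Fin n) (Fin n) ℝ) (Y₀ : Matrix (Fin m ⊕ Fin n) (Fin m ⊕ Fin n) ℝ)
    (hμ₀ : μ₀.IsSymm) (hY₀ : Y₀.IsSymm) :
    ∃ Z L S μ Y, IsLADMM A γ lam ρ τ Z L S μ Y ∧
      Z 0 = Z₀ ∧ L 0 = L₀ ∧ S 0 = S₀ ∧ μ 0 = μ₀ ∧ Y 0 = Y₀ := by
  -- The state carries the symmetry of `μ` and `Y`, which guarantees the next eigenvalue
  -- decomposition.
  let X := {s : Matrix (Fin m ⊕ Fin n) (Fin m ⊕ Fin n) ℝ × Matrix (Fin m) (Fin n) ℝ ×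
    Matrix (Fin m) (Fin n) ℝ × Matrix (Fin n) (Fin n) ℝ ×
    Matrix (Fin m ⊕ Fin n) (Fin m ⊕ Fin n) ℝ // s.2.2.2.1.IsSymm ∧ s.2.2.2.2.IsSymm}
  choose Z' L' S' μ' Y' hZ hL hS hμ hY hμs hYs using
    fun s : X => exists_step A γ lam ρ τ s.1.2.1 s.1.2.2.1 s.2.1 s.2.2
  let next : X → X := fun s => ⟨(Z' s, L' s, S' s, μ' s, Y' s), hμs s, hYs s⟩
  let seq : ℕ → X := fun k => next^[k] ⟨(Z₀, L₀, S₀, μ₀, Y₀), hμ₀, hY₀⟩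
  have hseq : ∀ k, seq (k + 1) = next (seq k) := fun k => Function.iterate_succ_apply' _ _ _
  refine ⟨fun k => (seq k).1.1, fun k => (seq k).1.2.1, fun k => (seq k).1.2.2.1,
    fun k => (seq k).1.2.2.2.1, fun k => (seq k).1.2.2.2.2,
    ⟨fun k => ?_, fun k => ?_, fun k => ?_, fun k => ?_, fun k => ?_⟩, rfl, rfl, rfl, rfl, rfl⟩
  · rw [hseq]
    exact hZ (seq k)
  · rw [hseq]
    exact hL (seq k)
  · rw [hseq]
    exact hS (seq k)
  · rw [hseq]
    exact hμ (seq k)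
  · rw [hseq]
    exact hY (seq k)

variable {Z : ℕ → Matrix (Fin m ⊕ Fin n) (Fin m ⊕ Fin n) ℝ}
  {L S : ℕ → Matrix (Fin m) (Fin n) ℝ} {μ : ℕ → Matrix (Fin n) (Fin n) ℝ}
  {Y : ℕ → Matrix (Fin m ⊕ Fin n) (Fin m ⊕ Fin n) ℝ}

/-- The predicted multiplier after step `k`. -/
def predictedY (A : Matrix (Fin m) (Fin n) ℝ) (γ ρ : ℝ)
    (Z : ℕ → Matrix (Fin m ⊕ Fin n) (Fin m ⊕ Fin n) ℝ)
    (L S : ℕ → Matrix (Fin m) (Fin n) ℝ) (μ : ℕ → Matrix (Fin n) (Fin n) ℝ)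
    (Y : ℕ → Matrix (Fin m ⊕ Fin n) (Fin m ⊕ Fin n) ℝ) (k : ℕ) :
    Matrix (Fin m ⊕ Fin n) (Fin m ⊕ Fin n) ℝ :=
  Y k + ρ • (Z (k + 1) - blockMat A γ (L k) (S k) (μ k))

lemma predictedY_eq_smul (hρ : ρ ≠ 0) (k : ℕ) : predictedY A γ ρ Z L S μ Y k
    = ρ • (Z (k + 1) - (blockMat A γ (L k) (S k) (μ k) - ρ⁻¹ • Y k)) := by
  rw [predictedY, sub_sub_eq_add_sub, add_sub_right_comm, smul_add, smul_smul,
    mul_inv_cancel₀ hρ, one_smul, add_comm]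

/-- The decomposition in step 1 already forces the projected matrix to be symmetric, so nothing is
required of the starting point. -/
lemma IsLADMM.isSymm_predictedY (h : IsLADMM A γ lam ρ τ Z L S μ Y) (hρ : ρ ≠ 0) (k : ℕ) :
    (predictedY A γ ρ Z L S μ Y k).IsSymm := by
  rw [predictedY_eq_smul hρ]
  exact ((posSemidef_iff_isSymm_quad.1 (h.stepZ k).posSemidef).1.sub (h.stepZ k).isSymm).smul ρ

/-- With its analogue for `μ`, this identifies step 2 as a proximal gradient step driven by the
predicted multiplier. -/
lemma incr_eq_predictedY (hρ : ρ ≠ 0) (k : ℕ) : incr A ρ (Z (k + 1)) (L k) (S k) (Y k)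
    = ρ⁻¹ • (predictedY A γ ρ Z L S μ Y k).toBlocks₁₂ := by
  ext i j
  simp only [incr, predictedY, blockMat, Matrix.toBlocks₁₂, Matrix.add_apply, Matrix.sub_apply,
    Matrix.smul_apply, Matrix.of_apply, Matrix.fromBlocks_apply₁₂, smul_eq_mul]
  field_simp
  ring

lemma mu_increment_eq_predictedY (hρ : ρ ≠ 0) (k : ℕ) :
    (Z (k + 1)).toBlocks₂₂ - γ • (A.transpose * A) + μ k + ρ⁻¹ • (Y k).toBlocks₂₂
    = ρ⁻¹ • (predictedY A γ ρ Z L S μ Y k).toBlocks₂₂ := by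
  ext i j
  simp only [predictedY, blockMat, Matrix.toBlocks₂₂, Matrix.add_apply, Matrix.sub_apply,
    Matrix.smul_apply, Matrix.of_apply, Matrix.fromBlocks_apply₂₂, smul_eq_mul]
  field_simp
  ring

lemma vec_predictedY (k : ℕ) : vec (Y k) + ρ • (vec (Z (k + 1))
      - opGVec m n (vec (stack (L k) (S k) (μ k))) - vec (blockMat A γ 0 0 0))
    = vec (predictedY A γ ρ Z L S μ Y k) := by
  rw [vec_sub_opGVec_sub, ← map_smul, ← map_add]
  rfl

/-- The variational inequality satisfied by the combined `L`, `S` and `μ` updates. -/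
lemma IsLADMM.prox (h : IsLADMM A γ lam ρ τ Z L S μ Y) (hρ : 0 < ρ) (hτ : 0 < τ) (hlam : 0 < lam)
    (k : ℕ) {y : Matrix (Fin m ⊕ Fin m ⊕ Fin n) (Fin n) ℝ} (hy : y ∈ nonnegStack m n) :
    objective lam (L (k + 1)) (S (k + 1))
      + ρ / τ * frobInner (stack (L k) (S k) (μ k) - stack (L (k + 1)) (S (k + 1)) (μ (k + 1)))
          (y - stack (L (k + 1)) (S (k + 1)) (μ (k + 1)))
      + frobInner (predictedY A γ ρ Z L S μ Y k)
          (opGStack m n (y - stack (L (k + 1)) (S (k + 1)) (μ (k + 1))))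
    ≤ objectiveStack lam y := by
  have hsymm := h.isSymm_predictedY hρ.ne' k
  have h1 := (h.stepL k).prox (div_pos hτ hρ) (lPart y)
  have h2 := l1Norm_prox (θ := τ * lam / ρ) (by positivity)
    (S k + (2 * τ) • incr A ρ (Z (k + 1)) (L k) (S k) (Y k)) (sPart y)
  have h3 := max_zero_prox (μ k - τ • ((Z (k + 1)).toBlocks₂₂ - γ • (A.transpose * A) + μ k
      + ρ⁻¹ • (Y k).toBlocks₂₂)) (muPart y) hy
  rw [← h.stepS k] at h2
  rw [← h.stepμ k] at h3
  rw [incr_eq_predictedY (γ := γ) (μ := μ) hρ.ne'] at h1 h2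
  rw [mu_increment_eq_predictedY (L := L) (S := S) hρ.ne'] at h3
  generalize predictedY A γ ρ Z L S μ Y k = Q at *
  -- Symmetry turns the adjoint block `Q₁₂ + Q₂₁ᵀ` into `2 Q₁₂`, which matches the factor `2 * τ` in
  -- the updates.
  have hQ : Q.toBlocks₂₁.transpose = Q.toBlocks₁₂ := by
    ext i j
    exact hsymm.apply _ _
  have hG : opGStack m n (y - stack (L (k + 1)) (S (k + 1)) (μ (k + 1)))
      = opG (lPart y - L (k + 1)) (sPart y - S (k + 1)) (muPart y - μ (k + 1)) := rfl
  have hy' : y = stack (lPart y) (sPart y) (muPart y) := by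
    ext (i | i | i) j <;> rfl
  have hI : frobInner (stack (L k) (S k) (μ k) - stack (L (k + 1)) (S (k + 1)) (μ (k + 1)))
      (y - stack (L (k + 1)) (S (k + 1)) (μ (k + 1)))
      = frobInner (L k - L (k + 1)) (lPart y - L (k + 1))
        + frobInner (S k - S (k + 1)) (sPart y - S (k + 1))
        + frobInner (μ k - μ (k + 1)) (muPart y - μ (k + 1)) := by
    rw [frobInner_eq_parts]
    rfl
  rw [hG, frobInner_opG, hQ, hI, objectiveStack, objective, objective]
  rw [add_sub_right_comm, frobInner_add_left, frobInner_smul_left, frobInner_smul_left] at h1 h2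
  rw [sub_right_comm, frobInner_sub_left, frobInner_smul_left, frobInner_smul_left] at h3
  rw [frobInner_add_left, frobInner_add_right]
  generalize lPart y - L (k + 1) = dl at *
  generalize sPart y - S (k + 1) = ds at *
  generalize muPart y - μ (k + 1) = dm at *
  -- The weight `ρ / τ` turns the thresholds `τ / ρ` and `τ * lam / ρ` into the objective weights 1
  -- and `lam`.
  have hsum := mul_le_mul_of_nonneg_left (add_le_add (add_le_add h1 h2) h3)
    (div_pos hρ hτ).le
  have e1 : ρ / τ * (τ / ρ * nuclearNorm (L (k + 1))
      + (frobInner (L k - L (k + 1)) dl + 2 * τ * (ρ⁻¹ * frobInner Q.toBlocks₁₂ dl))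
      + (τ * lam / ρ * l1Norm (S (k + 1))
      + (frobInner (S k - S (k + 1)) ds + 2 * τ * (ρ⁻¹ * frobInner Q.toBlocks₁₂ ds)))
      + (frobInner (μ k - μ (k + 1)) dm - τ * (ρ⁻¹ * frobInner Q.toBlocks₂₂ dm)))
      = nuclearNorm (L (k + 1)) + lam * l1Norm (S (k + 1))
        + ρ / τ * (frobInner (L k - L (k + 1)) dl + frobInner (S k - S (k + 1)) ds
          + frobInner (μ k - μ (k + 1)) dm)
        + 2 * frobInner Q.toBlocks₁₂ dl + 2 * frobInner Q.toBlocks₁₂ ds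
        - frobInner Q.toBlocks₂₂ dm := by
    field_simp
    ring
  have e2 : ρ / τ * (τ / ρ * nuclearNorm (lPart y) + τ * lam / ρ * l1Norm (sPart y) + 0)
      = nuclearNorm (lPart y) + lam * l1Norm (sPart y) := by
    field_simp
    ring
  rw [e1, e2] at hsum
  linarith

/-- The iteration is an instance of the abstract linearized ADMM. -/
theorem IsLADMM.isLinearizedADMM (h : IsLADMM A γ lam ρ τ Z L S μ Y) (hρ : 0 < ρ) (hτ : 0 < τ)
    (hlam : 0 < lam) : IsLinearizedADMM (psdVec m n) (nonnegVec m n) (objectiveVec lam)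
      (opGVec m n) (vec (blockMat A γ 0 0 0)) ρ τ (fun k => vec (Z k))
      (fun k => vec (stack (L k) (S k) (μ k))) (fun k => vec (Y k)) where
  mem_K k := (h.stepZ k).posSemidef
  mem_C k := by
    intro i j
    have : muPart (vec.symm (vec (stack (L (k + 1)) (S (k + 1)) (μ (k + 1))))) = μ (k + 1) := rfl
    rw [this, h.stepμ k]
    exact le_max_right _ _
  proj k W hW := by
    obtain ⟨W, rfl⟩ := vec.surjective W
    rw [vec_predictedY, ← map_sub, inner_vec, predictedY_eq_smul hρ.ne', frobInner_smul_left]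
    exact mul_nonneg hρ.le ((h.stepZ k).frobInner_nonneg hW)
  prox k v hv := by
    obtain ⟨y, rfl⟩ := vec.surjective v
    rw [vec_predictedY, ← map_sub, ← map_sub, opGVec_vec, inner_vec, inner_vec]
    exact h.prox hρ hτ hlam k hv
  dual k := by
    rw [vec_sub_opGVec_sub, ← map_smul, ← map_add, h.stepY k]
    rfl

lemma vec_avg {p q : Type*} [Fintype p] [Fintype q] (X : ℕ → Matrix p q ℝ) (k : ℕ) :
    vec (avg X k) = (k : ℝ)⁻¹ • ∑ j ∈ Finset.range k, vec (X (j + 1)) := by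
  rw [avg, map_smul, map_sum]

lemma tendsto_of_tendsto_vec {p q : Type*} [Fintype p] [Fintype q] {X : ℕ → Matrix p q ℝ}
    {x : EuclideanSpace ℝ (p × q)} (h : Tendsto (fun k => vec (X k)) atTop (𝓝 x)) :
    Tendsto X atTop (𝓝 (vec.symm x)) :=
  (continuous_vec_symm.tendsto x).comp h

theorem IsLADMM.lagrangian_gap_le (h : IsLADMM A γ lam ρ τ Z L S μ Y) (hρ : 0 < ρ) (hτ : 0 < τ)
    (hτ' : τ < 1 / 4) (hlam : 0 < lam) {k : ℕ} (hk : 1 ≤ k)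
    {Z' : Matrix (Fin m ⊕ Fin n) (Fin m ⊕ Fin n) ℝ} (L' S' : Matrix (Fin m) (Fin n) ℝ)
    {μ' : Matrix (Fin n) (Fin n) ℝ} (Y' : Matrix (Fin m ⊕ Fin n) (Fin m ⊕ Fin n) ℝ)
    (hZ' : Z'.PosSemidef) (hμ' : ∀ i j, 0 ≤ μ' i j) :
    lagrangian A γ lam (avg Z k) (avg L k) (avg S k) (avg μ k) Y'
      - lagrangian A γ lam Z' L' S' μ' (avgPredictedY A γ ρ Z L S μ Y k)
    ≤ (ρ / τ * (frobNorm (L' - L 0) ^ 2 + frobNorm (S' - S 0) ^ 2 + frobNorm (μ' - μ 0) ^ 2)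
        + 1 / ρ * frobNorm (Y' - Y 0) ^ 2) / (2 * k) := by
  have hk0 : (k : ℝ) ≠ 0 := by
    have : k ≠ 0 := by omega
    exact_mod_cast this
  have hgap := (h.isLinearizedADMM hρ hτ hlam).ergodic_gap_le hρ hτ hτ' norm_opGVec_le
    (convexOn_objectiveVec hlam.le) hk (W := vec Z') hZ' (v := vec (stack L' S' μ')) hμ' (vec Y')
  simp only [vec_predictedY] at hgap
  have hpred : (k : ℝ)⁻¹ • ∑ j ∈ Finset.range k, vec (predictedY A γ ρ Z L S μ Y j)
      = vec (avgPredictedY A γ ρ Z L S μ Y k) := by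
    rw [avgPredictedY, map_smul, map_sum]
    rfl
  rw [hpred, ← vec_avg Z, ← vec_avg fun j => stack (L j) (S j) (μ j), avg_stack,
    vec_sub_opGVec_sub, vec_sub_opGVec_sub, inner_vec, inner_vec, potential, ← map_sub, ← map_sub,
    norm_vec, norm_vec, stack_sub, frobNorm_stack_sq] at hgap
  refine le_of_le_of_eq hgap ?_
  field_simp

theorem IsLADMM.exists_optimal_limit (h : IsLADMM A γ lam ρ τ Z L S μ Y) (hγ : 0 < γ)
    (hlam : 0 < lam) (hρ : 0 < ρ) (hτ : 0 < τ) (hτ' : τ < 1 / 4)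
    (hA : ∀ x : Fin n → ℝ, (∀ j, 0 ≤ x j) → A.mulVec x = 0 → x = 0) :
    ∃ Zs Ls Ss μs, IsOptimal A γ lam Zs Ls Ss μs ∧
      Tendsto Z atTop (𝓝 Zs) ∧ Tendsto L atTop (𝓝 Ls) ∧
      Tendsto S atTop (𝓝 Ss) ∧ Tendsto μ atTop (𝓝 μs) ∧
      ∃ C : ℝ, ∀ k : ℕ, 1 ≤ k →
        |objective lam (avg L k) (avg S k) - objective lam Ls Ss| ≤ C / k ∧
        frobNorm (avg Z k - blockMat A γ (avg L k) (avg S k) (avg μ k)) ≤ C / k := by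
  have hadmm := h.isLinearizedADMM hρ hτ hlam
  obtain ⟨v, P, hs, hy, -, hZ⟩ := hadmm.exists_tendsto hρ hτ hτ' norm_opGVec_le
    (isClosed_posSemidef.preimage continuous_vec_symm)
    (isClosed_nonnegStack.preimage continuous_vec_symm)
    ((continuous_objectiveStack lam).comp continuous_vec_symm) (exists_isSaddle A hγ hlam hA)
  obtain ⟨C, hC⟩ := hadmm.ergodic_rate hρ hτ hτ' norm_opGVec_le (convexOn_objectiveVec hlam.le)
    (convex_posSemidef.linear_preimage vec.symm.toLinearMap) hs
  obtain ⟨y, rfl⟩ := vec.surjective v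
  rw [opGVec_add] at hZ
  have hZ' := tendsto_of_tendsto_vec hZ
  have hy' := tendsto_of_tendsto_vec hy
  rw [LinearEquiv.symm_apply_apply] at hZ' hy'
  refine ⟨blockStack A γ y, lPart y, sPart y, muPart y, ⟨⟨?_, hs.mem_C, sub_self _⟩, ?_⟩, hZ',
    (continuous_lPart.tendsto y).comp hy', (continuous_sPart.tendsto y).comp hy',
    (continuous_muPart.tendsto y).comp hy', C, fun k hk => ?_⟩
  · have := hs.mem_K
    rwa [opGVec_add] at this
  · rintro Z' L' S' μ' ⟨hZ', hμ', hfeas⟩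
    have := hs.le (vec Z') hZ' (vec (stack L' S' μ')) hμ'
    rw [vec_sub_opGVec_sub] at this
    have e : Z' - blockStack A γ (stack L' S' μ') = 0 := hfeas
    rw [e, map_zero, inner_zero_right, add_zero] at this
    exact this
  · obtain ⟨h1, h2⟩ := hC k hk
    rw [← vec_avg fun j => stack (L j) (S j) (μ j), avg_stack] at h1 h2
    rw [← vec_avg Z, vec_sub_opGVec_sub, norm_vec] at h2
    exact ⟨h1, h2⟩

end Iteration

end

end ConePreserving

theorem mainTheorem12 {m n : ℕ} (A : Matrix (Fin m) (Fin n) ℝ) (γ lam ρ τ : ℝ)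
    (hγ : 0 < γ) (hlam : 0 < lam) (hρ : 0 < ρ) (hτ : 0 < τ) (hτ' : τ < 0.25)
    -- the cone generated by the columns of `A` is pointed and no column is zero
    (hA : ∀ x : Fin n → ℝ, (∀ j, 0 ≤ x j) → A.mulVec x = 0 → x = 0) :
    -- the operator norm of `𝒢` is `2`
    (0 < m → 0 < n → IsLUB {r : ℝ | ∃ (L S : Matrix (Fin m) (Fin n) ℝ)
        (μ : Matrix (Fin n) (Fin n) ℝ),
        ConePreserving.frobNorm L ^ 2 + ConePreserving.frobNorm S ^ 2
          + ConePreserving.frobNorm μ ^ 2 = 1 ∧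
        r = ConePreserving.frobNorm (ConePreserving.opG L S μ)} 2) ∧
    -- the iteration can be run from any starting point
    (∀ (Z₀ : Matrix (Fin m ⊕ Fin n) (Fin m ⊕ Fin n) ℝ) (L₀ S₀ : Matrix (Fin m) (Fin n) ℝ)
      (μ₀ : Matrix (Fin n) (Fin n) ℝ) (Y₀ : Matrix (Fin m ⊕ Fin n) (Fin m ⊕ Fin n) ℝ),
      μ₀.IsSymm → Y₀.IsSymm →
      ∃ Z L S μ Y, ConePreserving.IsLADMM A γ lam ρ τ Z L S μ Y ∧
        Z 0 = Z₀ ∧ L 0 = L₀ ∧ S 0 = S₀ ∧ μ 0 = μ₀ ∧ Y 0 = Y₀) ∧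
    -- every run converges to an optimal solution, with rate `O(1/k)`
    (∀ Z L S μ Y, ConePreserving.IsLADMM A γ lam ρ τ Z L S μ Y →
      (∃ Zs Ls Ss μs, ConePreserving.IsOptimal A γ lam Zs Ls Ss μs ∧
        Tendsto Z atTop (𝓝 Zs) ∧ Tendsto L atTop (𝓝 Ls) ∧
        Tendsto S atTop (𝓝 Ss) ∧ Tendsto μ atTop (𝓝 μs) ∧
        ∃ C : ℝ, ∀ k : ℕ, 1 ≤ k →
          |ConePreserving.objective lam (ConePreserving.avg L k) (ConePreserving.avg S k)
            - ConePreserving.objective lam Ls Ss| ≤ C / k ∧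
          ConePreserving.frobNorm (ConePreserving.avg Z k
            - ConePreserving.blockMat A γ (ConePreserving.avg L k) (ConePreserving.avg S k)
                (ConePreserving.avg μ k)) ≤ C / k) ∧
      (∀ k : ℕ, 1 ≤ k → ∀ Z' L' S' μ' Y', Z'.PosSemidef → (∀ i j, 0 ≤ μ' i j) →
        ConePreserving.lagrangian A γ lam (ConePreserving.avg Z k) (ConePreserving.avg L k)
            (ConePreserving.avg S k) (ConePreserving.avg μ k) Y'
          - ConePreserving.lagrangian A γ lam Z' L' S' μ'
              (ConePreserving.avgPredictedY A γ ρ Z L S μ Y k)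
        ≤ (ρ / τ * (ConePreserving.frobNorm (L' - L 0) ^ 2
                + ConePreserving.frobNorm (S' - S 0) ^ 2
                + ConePreserving.frobNorm (μ' - μ 0) ^ 2)
              + 1 / ρ * ConePreserving.frobNorm (Y' - Y 0) ^ 2) / (2 * k))) := by

  have hτ4 : τ < 1 / 4 := by norm_num at hτ' ⊢; exact hτ'
  refine ⟨fun hm hn => ConePreserving.isLUB_frobNorm_opG hm hn,
    fun Z₀ L₀ S₀ μ₀ Y₀ hμ₀ hY₀ =>
      ConePreserving.exists_isLADMM A γ lam ρ τ Z₀ L₀ S₀ μ₀ Y₀ hμ₀ hY₀,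
    fun Z L S μ Y h => ⟨h.exists_optimal_limit hγ hlam hρ hτ hτ4 hA,
      fun k hk Z' L' S' μ' Y' hZ' hμ' =>
        h.lagrangian_gap_le hρ hτ hτ4 hlam hk L' S' Y' hZ' hμ'⟩⟩
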